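/- Fix $k\in(0,1)$ and put $k'=\sqrt{1-k^2}$, $F(\varphi,k)=\int_0^{\varphi}\frac{dt}{\sqrt{1-k^2\sin^2 t}}$, $K=F(\pi/2,k)$, $K'=F(\pi/2,k')$, $q=e^{-\pi K'/K}$. For $x\in\mathbb{C}$ let $$H(x)=\theta_1\!\left(\tfrac{\pi x}{2K}\right),\qquad \Theta(x)=\theta_4\!\left(\tfrac{\pi x}{2K}\right),\qquad \mathrm{cn}(x,k)=\frac{\theta_4(0)}{\theta_2(0)}\,\frac{\theta_2(\pi x/2K)}{\theta_4(\pi x/2K)},$$ where $$\theta_1(u)=2\sum_{n\ge1}(-1)^{n-1}q^{(n-1/2)^2}\sin(2n-1)u,\quad \theta_2(u)=2\sum_{n\ge1}q^{(n-1/2)^2}\cos(2n-1)u,\quad \theta_4(u)=1+2\sum_{n\ge1}(-1)^nq^{n^2}\cos 2nu .$$ Let $\lambda\in\mathbb{R}$ and let $\alpha\in\mathbb{C}$ be any solution (not a pole of $\mathrm{cn}$) of the characteristic equation $$\lambda=1-2k^2+k^2\,\mathrm{cn}^2(\alpha,k),$$ or the following explicit value: $\alpha=F(\varphi_\alpha,k)$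 with $\varphi_\alpha\in[0,\frac{\pi}{2}]$, $\sin\varphi_\alpha=\frac{\sqrt{1-k^2-\lambda}}{k}$, if $\lambda\in[1-2k^2,1-k^2]$; $\alpha=K+iF(\varphi_\beta,k')$ with $\varphi_\beta\in[0,\frac{\pi}{2}]$, $\sin\varphi_\beta=\frac{\sqrt{1-2k^2-\lambda}}{\sqrt{(1-k^2)(1-k^2-\lambda)}}$, if $\lambda\in[-k^2,1-2k^2]$; $\alpha=K+iK'+F(\varphi_\gamma,k)$ with $\varphi_\gamma\in[0,\frac{\pi}{2})$, $\sin\varphi_\gamma=\frac{\sqrt{-k^2-\lambda}}{\sqrt{1-2k^2-\lambda}}$, if $\lambda\le -k^2$. Define $$\omega(\alpha)=4(\lambda+k^2-1)\left[\frac{\Theta'(\alpha)}{\Theta(\alpha)}-\frac{H'(\alpha)}{H(\alpha)}\right].$$ If $\lambda\in(-\infty,-k^2)\cup(1-2k^2,1-k^2)$, then $\Theta(\alpha)\neq0$, $H(\alpha)\ne0$ and $\omega(\alpha)\in\mathbb{R}$. If $\lambda\in[-k^2,1-2k^2]$, then $\Theta(\alpha)\neq0$, $H(\alpha)\ne0$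 and $\omega(\alpha)\in i\mathbb{R}$. -/

import Mathlib

noncomputable section

namespace LameKdV

/-- Incomplete elliptic integral of the first kind `F(φ, k)`. -/
def ellipticF (φ k : ℝ) : ℝ :=
  ∫ t in (0 : ℝ)..φ, 1 / Real.sqrt (1 - k ^ 2 * Real.sin t ^ 2)

/-- Complete elliptic integral of the first kind `K(k)`. -/
def ellipticK (k : ℝ) : ℝ := ellipticF (Real.pi / 2) k

/-- Complementary modulus `k' = √(1 - k²)`. -/
def compl (k : ℝ) : ℝ := Real.sqrt (1 - k ^ 2)

/-- `K'(k) = K(k')`. -/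
def ellipticK' (k : ℝ) : ℝ := ellipticK (compl k)

/-- The Jacobi nome `q = exp(-π K'(k) / K(k))`. -/
def nome (k : ℝ) : ℝ := Real.exp (-(Real.pi * ellipticK' k / ellipticK k))

/-- `θ₁(u) = 2 ∑_{n ≥ 1} (-1)^{n-1} q^{(n-1/2)²} sin((2n-1)u)` (with the index shifted by one). -/
def theta1 (q : ℝ) (u : ℂ) : ℂ :=
  2 * ∑' n : ℕ, (-1 : ℂ) ^ n * ((q ^ (((n : ℝ) + 1 / 2) ^ 2) : ℝ) : ℂ) *
    Complex.sin ((2 * (n : ℂ) + 1) * u)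

/-- `θ₂(u) = 2 ∑_{n ≥ 1} q^{(n-1/2)²} cos((2n-1)u)` (with the index shifted by one). -/
def theta2 (q : ℝ) (u : ℂ) : ℂ :=
  2 * ∑' n : ℕ, ((q ^ (((n : ℝ) + 1 / 2) ^ 2) : ℝ) : ℂ) *
    Complex.cos ((2 * (n : ℂ) + 1) * u)

/-- `θ₄(u) = 1 + 2 ∑_{n ≥ 1} (-1)^n q^{n²} cos(2nu)` (with the index shifted by one). -/
def theta4 (q : ℝ) (u : ℂ) : ℂ :=
  1 + 2 * ∑' n : ℕ, (-1 : ℂ) ^ (n + 1) * ((q ^ ((n + 1) ^ 2) : ℝ) : ℂ) *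
    Complex.cos (2 * ((n : ℂ) + 1) * u)

/-- The rescaled argument `π x / (2 K(k))`. -/
def scaledArg (k : ℝ) (x : ℂ) : ℂ := (Real.pi : ℂ) * x / (2 * (ellipticK k : ℂ))

/-- Jacobi's eta function `H(x) = θ₁(π x / (2K))`. -/
def jacobiH (k : ℝ) (x : ℂ) : ℂ := theta1 (nome k) (scaledArg k x)

/-- Jacobi's theta function `Θ(x) = θ₄(π x / (2K))`. -/
def jacobiTheta (k : ℝ) (x : ℂ) : ℂ := theta4 (nome k) (scaledArg k x)

/-- The Jacobi elliptic function `cn(x, k)` of a complex argument, by the classical theta quotient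
`cn(x, k) = (θ₄(0) / θ₂(0)) · (θ₂(ζ) / θ₄(ζ))`, `ζ = π x / (2K)`. Its poles are the zeros of `Θ`. -/
def jacobiCn (k : ℝ) (x : ℂ) : ℂ :=
  theta4 (nome k) 0 / theta2 (nome k) 0 *
    (theta2 (nome k) (scaledArg k x) / theta4 (nome k) (scaledArg k x))

/-- `α` is not a pole of `cn` and solves the characteristic equation
`λ = 1 - 2k² + k² cn²(α, k)`. -/
def CharacteristicEq (k lam : ℝ) (α : ℂ) : Prop :=
  jacobiTheta k α ≠ 0 ∧ (lam : ℂ) = 1 - 2 * (k : ℂ) ^ 2 + (k : ℂ) ^ 2 * jacobiCn k α ^ 2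

/-- The explicit choice of the parameter `α` along the path on which `λ` decreases from `1 - k²`
to `-∞`: `α ∈ [0, K]`, then `α = K + iβ` with `β ∈ [0, K']`, then `α = K + iK' + γ` with
`γ ∈ [0, K)`. (Only used for `λ ≤ 1 - k²`; adjacent formulas agree at the band edges.) -/
def pathAlpha (k lam : ℝ) : ℂ :=
  if 1 - 2 * k ^ 2 ≤ lam then
    (ellipticF (Real.arcsin (Real.sqrt (1 - k ^ 2 - lam) / k)) k : ℂ)
  else if -k ^ 2 ≤ lam then
    (ellipticK k : ℂ) + Complex.I *
      (ellipticF (Real.arcsin (Real.sqrt (1 - 2 * k ^ 2 - lam) /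
        Real.sqrt ((1 - k ^ 2) * (1 - k ^ 2 - lam)))) (compl k) : ℂ)
  else
    (ellipticK k : ℂ) + Complex.I * (ellipticK' k : ℂ) +
      (ellipticF (Real.arcsin (Real.sqrt (-k ^ 2 - lam) /
        Real.sqrt (1 - 2 * k ^ 2 - lam))) k : ℂ)

/-- The temporal frequency
`ω(α) = 4(λ + k² - 1) [Θ'(α)/Θ(α) - H'(α)/H(α)]`. -/
def omega (k lam : ℝ) (α : ℂ) : ℂ :=
  4 * ((lam : ℂ) + (k : ℂ) ^ 2 - 1) *
    (deriv (jacobiTheta k) α / jacobiTheta k α - deriv (jacobiH k) α / jacobiH k α)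

end LameKdV

end

noncomputable section

open Complex Real Set Filter Topology

namespace LameKdV

/-! ### Theta functions on the imaginary axis -/

/-! Since `H/Θ` is a constant multiple of sn, the bracket in ω is -sn'/sn = -cn dn/sn. The
characteristic equation makes the prefactor λ + k² - 1 equal to -k² sn², so ω = 4k² sn cn dn.
Squaring, and writing sn², cn², dn² as affine functions of λ, gives ω² = 16(1-k²-λ)(λ-1+2k²)(λ+k²)
(`omega_sq`). This is real, and its sign on each interval decides whether ω is real or imaginary.
`Θ` does not vanish because α is not a pole of cn; `H` does not vanish because sn² ≠ 0 once λ ≠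
1-k².

The work lies in the theory behind sn' = cn dn, with k, K and q tied together through elliptic
integrals. Everything is parametrised by t > 0 with q = exp(-πt). One rearrangement of double series
(`th3_mul_th3`) yields the quadratic identities, the duplication of θ₁ and, after a shift, the
Wronskian (`wronskian_th1_th4`), so no argument about entire doubly periodic functions is needed.

Each k in (0,1) is θ₂(0)²/θ₃(0)² for some t (`exists_modulus_eq`). The elliptic integral inverts the
theta quotient (`ellipticF_arcsin_thSn`), which identifies 2K with `thScale`. The imaginary
transformation then gives K' = tK, hence the nome is exp(-πt) (`nome_modulus`). The inversion, with
the shifts by K and K + iK', also shows that the explicit α solves the characteristic equation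
(`characteristicEq_pathAlpha`). -/

/-- `θ₃(πz)` with parameter `τ = it`. -/
def th3 (t : ℝ) (z : ℂ) : ℂ := jacobiTheta₂ z (I * t)

/-- `θ₂(πz)` with parameter `τ = it`. -/
def th2 (t : ℝ) (z : ℂ) : ℂ := cexp (-π * t / 4 + π * I * z) * th3 t (z + I * t / 2)

/-- `θ₄(πz)` with parameter `τ = it`. -/
def th4 (t : ℝ) (z : ℂ) : ℂ := th3 t (z + 1 / 2)

/-- `θ₁(πz)` with parameter `τ = it`. -/
def th1 (t : ℝ) (z : ℂ) : ℂ := th2 t (z - 1 / 2)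

lemma im_I_mul_pos {t : ℝ} (ht : 0 < t) : 0 < (I * (t : ℂ)).im := by simpa using ht

lemma differentiable_th3 {t : ℝ} (ht : 0 < t) : Differentiable ℂ (th3 t) := fun z =>
  differentiableAt_jacobiTheta₂_fst z (im_I_mul_pos ht)

lemma differentiable_th2 {t : ℝ} (ht : 0 < t) : Differentiable ℂ (th2 t) := by
  have := differentiable_th3 ht
  unfold th2
  fun_prop

lemma differentiable_th1 {t : ℝ} (ht : 0 < t) : Differentiable ℂ (th1 t) := by
  have := differentiable_th2 ht
  unfold th1
  fun_prop

lemma differentiable_th4 {t : ℝ} (ht : 0 < t) : Differentiable ℂ (th4 t) := by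
  have := differentiable_th3 ht
  unfold th4
  fun_prop

lemma th3_add_one (t : ℝ) (z : ℂ) : th3 t (z + 1) = th3 t z := jacobiTheta₂_add_left z _

lemma th3_neg (t : ℝ) (z : ℂ) : th3 t (-z) = th3 t z := jacobiTheta₂_neg_left z _

lemma th3_add_period (t : ℝ) (z : ℂ) :
    th3 t (z + I * t) = cexp (π * t - 2 * π * I * z) * th3 t z := by
  unfold th3
  rw [jacobiTheta₂_add_left']
  congr 2
  linear_combination -π * t * I_sq

lemma th2_add_one (t : ℝ) (z : ℂ) : th2 t (z + 1) = -th2 t z := by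
  unfold th2
  rw [show z + 1 + I * t / 2 = z + I * t / 2 + 1 by ring, th3_add_one,
    show -π * t / 4 + π * I * (z + 1) = -π * t / 4 + π * I * z + π * I by ring,
    Complex.exp_add _ (π * I), Complex.exp_pi_mul_I]
  ring

lemma th2_neg (t : ℝ) (z : ℂ) : th2 t (-z) = th2 t z := by
  unfold th2
  rw [← th3_neg t (-z + I * t / 2),
    show z + I * t / 2 = -(-z + I * t / 2) + I * t by ring, th3_add_period, ← mul_assoc,
    ← Complex.exp_add]
  congr 2
  linear_combination (-π * t) * I_sq

lemma th2_add_half_period (t : ℝ) (z : ℂ) :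
    th2 t (z + I * t / 2) = cexp (π * t / 4 - π * I * z) * th3 t z := by
  unfold th2
  rw [show z + I * t / 2 + I * t / 2 = z + I * t by ring, th3_add_period, ← mul_assoc,
    ← Complex.exp_add]
  congr 2
  linear_combination (π * t / 2) * I_sq

lemma th3_add_half_period (t : ℝ) (z : ℂ) :
    th3 t (z + I * t / 2) = cexp (π * t / 4 - π * I * z) * th2 t z := by
  unfold th2
  rw [← mul_assoc, ← Complex.exp_add]
  ring_nf
  simp

lemma th2_half (t : ℝ) : th2 t (1 / 2) = 0 := by
  have h := th2_add_one t (-(1 / 2))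
  rw [show -(1 / 2 : ℂ) + 1 = 1 / 2 by norm_num, th2_neg] at h
  exact self_eq_neg.mp h

lemma th3_conj (t : ℝ) (z : ℂ) : (starRingEnd ℂ) (th3 t z) = th3 t ((starRingEnd ℂ) z) := by
  unfold th3
  rw [jacobiTheta₂_conj]
  simp

lemma th2_conj (t : ℝ) (z : ℂ) : (starRingEnd ℂ) (th2 t z) = th2 t ((starRingEnd ℂ) z) := by
  rw [← th2_neg t ((starRingEnd ℂ) z)]
  unfold th2
  rw [map_mul, th3_conj, ← th3_neg, ← Complex.exp_conj]
  simp only [map_add, map_mul, map_div₀, map_neg, conj_ofReal, conj_I, map_ofNat]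
  ring_nf

/-! ### The product formula -/

/-- Pairs of integers of equal, respectively opposite, parity, in rotated coordinates. -/
lemma bijective_rotate : Function.Bijective
    (Sum.elim (fun p : ℤ × ℤ => (p.1 + p.2, p.1 - p.2))
      (fun p : ℤ × ℤ => (p.1 + p.2 + 1, p.1 - p.2))) := by
  constructor
  · rintro (⟨a, b⟩ | ⟨a, b⟩) (⟨c, d⟩ | ⟨c, d⟩) h <;>
      simp only [Sum.elim_inl, Sum.elim_inr, Prod.mk.injEq] at h <;>
      simp only [Sum.inl.injEq, Sum.inr.injEq, Prod.mk.injEq, reduceCtorEq] <;> omega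
  · rintro ⟨m, n⟩
    rcases Int.even_or_odd' (m + n) with ⟨a, ha | ha⟩
    · refine ⟨Sum.inl (a, a - n), ?_⟩
      simp only [Sum.elim_inl, Prod.mk.injEq]; omega
    · refine ⟨Sum.inr (a, a - n), ?_⟩
      simp only [Sum.elim_inr, Prod.mk.injEq]; omega

lemma summable_norm_th3 {t : ℝ} (ht : 0 < t) (z : ℂ) :
    Summable fun n : ℤ => ‖jacobiTheta₂_term n z (I * t)‖ :=
  ((summable_jacobiTheta₂_term_iff z _).mpr (im_I_mul_pos ht)).norm

lemma hasSum_th3_mul {t : ℝ} (ht : 0 < t) (x y : ℂ) :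
    HasSum (fun p : ℤ × ℤ => jacobiTheta₂_term p.1 x (I * t) * jacobiTheta₂_term p.2 y (I * t))
      (th3 t x * th3 t y) := by
  have hx := summable_norm_th3 ht x
  have hy := summable_norm_th3 ht y
  have h := (summable_mul_of_summable_norm hx hy).hasSum
  rwa [← tsum_mul_tsum_of_summable_norm hx hy] at h

/-- The double series over (m, n) splits by the parity of m + n. With m = a + b, n = a - b one has
m² + n² = 2(a² + b²), which doubles the parameter; opposite parity shifts both new indices by 1/2,
turning θ₃ into θ₂. -/
theorem th3_mul_th3 {t : ℝ} (ht : 0 < t) (x y : ℂ) :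
    th3 t x * th3 t y = th3 (2 * t) (x + y) * th3 (2 * t) (x - y) +
      th2 (2 * t) (x + y) * th2 (2 * t) (x - y) := by
  have h2t : 0 < 2 * t := by positivity
  have h := hasSum_th3_mul ht x y
  rw [← (Equiv.ofBijective _ bijective_rotate).hasSum_iff] at h
  have h1 := hasSum_th3_mul h2t (x + y) (x - y)
  have h2 := (hasSum_th3_mul h2t (x + y + I * (2 * t : ℝ) / 2) (x - y + I * (2 * t : ℝ) / 2)).mul_left
    (cexp (-π * (2 * t : ℝ) / 4 + π * I * (x + y)) * cexp (-π * (2 * t : ℝ) / 4 + π * I * (x - y)))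
  have key := HasSum.sum (f := (fun p : ℤ × ℤ => jacobiTheta₂_term p.1 x (I * t) *
      jacobiTheta₂_term p.2 y (I * t)) ∘ (Equiv.ofBijective _ bijective_rotate))
      (a := th3 (2 * t) (x + y) * th3 (2 * t) (x - y))
      (b := th2 (2 * t) (x + y) * th2 (2 * t) (x - y)) ?_ ?_
  · exact h.unique key
  · convert h1 using 2 with p
    simp only [Function.comp_apply, Equiv.ofBijective_apply, Sum.elim_inl, jacobiTheta₂_term,
      ← Complex.exp_add]
    congr 1
    push_cast
    ring
  · rw [show th2 (2 * t) (x + y) * th2 (2 * t) (x - y) =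
      cexp (-π * (2 * t : ℝ) / 4 + π * I * (x + y)) * cexp (-π * (2 * t : ℝ) / 4 + π * I * (x - y)) *
      (th3 (2 * t) (x + y + I * (2 * t : ℝ) / 2) * th3 (2 * t) (x - y + I * (2 * t : ℝ) / 2)) by
        unfold th2; ring]
    refine Eq.mpr (congrArg (fun f => HasSum f _) (funext fun p => ?_)) h2
    simp only [Function.comp_apply, Equiv.ofBijective_apply, Sum.elim_inr, jacobiTheta₂_term,
      ← Complex.exp_add]
    congr 1
    push_cast
    linear_combination (π * t) * I_sq

theorem th2_mul_th2 {t : ℝ} (ht : 0 < t) (x y : ℂ) :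
    th2 t x * th2 t y = th3 (2 * t) (x + y) * th2 (2 * t) (x - y) +
      th2 (2 * t) (x + y) * th3 (2 * t) (x - y) := by
  have h := th3_mul_th3 ht (x + I * t / 2) (y + I * t / 2)
  rw [show x + I * t / 2 + (y + I * t / 2) = x + y + I * (2 * t : ℝ) / 2 by push_cast; ring,
    show x + I * t / 2 - (y + I * t / 2) = x - y by ring, th2_add_half_period,
    th3_add_half_period (2 * t)] at h
  rw [show th2 t x * th2 t y = cexp (-π * t / 4 + π * I * x) * cexp (-π * t / 4 + π * I * y) *
    (th3 t (x + I * t / 2) * th3 t (y + I * t / 2)) by unfold th2; ring, h, ← Complex.exp_add]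
  have e : cexp (-π * t / 4 + π * I * x + (-π * t / 4 + π * I * y)) *
      cexp (π * (2 * t : ℝ) / 4 - π * I * (x + y)) = 1 := by
    rw [← Complex.exp_add, ← Complex.exp_zero]
    congr 1
    push_cast
    ring
  linear_combination (th2 (2 * t) (x + y) * th3 (2 * t) (x - y) +
    th3 (2 * t) (x + y) * th2 (2 * t) (x - y)) * e

/-! ### Quadratic identities -/

lemma th3_sq {t : ℝ} (ht : 0 < t) (z : ℂ) : th3 t z ^ 2 =
    th3 (2 * t) 0 * th3 (2 * t) (2 * z) + th2 (2 * t) 0 * th2 (2 * t) (2 * z) := by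
  rw [sq, th3_mul_th3 ht, sub_self, two_mul z]; ring

lemma th2_sq {t : ℝ} (ht : 0 < t) (z : ℂ) : th2 t z ^ 2 =
    th2 (2 * t) 0 * th3 (2 * t) (2 * z) + th3 (2 * t) 0 * th2 (2 * t) (2 * z) := by
  rw [sq, th2_mul_th2 ht, sub_self, two_mul z]; ring

lemma th4_sq {t : ℝ} (ht : 0 < t) (z : ℂ) : th4 t z ^ 2 =
    th3 (2 * t) 0 * th3 (2 * t) (2 * z) - th2 (2 * t) 0 * th2 (2 * t) (2 * z) := by
  rw [th4, th3_sq ht, show 2 * (z + 1 / 2) = 2 * z + 1 by ring, th3_add_one, th2_add_one]; ring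

lemma th1_sq {t : ℝ} (ht : 0 < t) (z : ℂ) : th1 t z ^ 2 =
    th2 (2 * t) 0 * th3 (2 * t) (2 * z) - th3 (2 * t) 0 * th2 (2 * t) (2 * z) := by
  have h3 := th3_add_one (2 * t) (2 * (z - 1 / 2))
  have h2 := th2_add_one (2 * t) (2 * (z - 1 / 2))
  rw [show 2 * (z - 1 / 2) + 1 = 2 * z by ring] at h2 h3
  rw [th1, th2_sq ht, h3, h2]; ring

/-- The identity `sn² + cn² = 1`. -/
theorem th1_sq_add_th2_sq {t : ℝ} (ht : 0 < t) (z : ℂ) :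
    th1 t z ^ 2 * th3 t 0 ^ 2 + th2 t z ^ 2 * th4 t 0 ^ 2 = th4 t z ^ 2 * th2 t 0 ^ 2 := by
  rw [th1_sq ht, th2_sq ht z, th4_sq ht z, th3_sq ht, th4_sq ht, th2_sq ht, mul_zero]; ring

/-- The identity `k² sn² + dn² = 1`. -/
theorem th1_sq_add_th3_sq {t : ℝ} (ht : 0 < t) (z : ℂ) :
    th1 t z ^ 2 * th2 t 0 ^ 2 + th3 t z ^ 2 * th4 t 0 ^ 2 = th4 t z ^ 2 * th3 t 0 ^ 2 := by
  rw [th1_sq ht, th3_sq ht z, th4_sq ht z, th3_sq ht, th4_sq ht, th2_sq ht, mul_zero]; ring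

/-- Jacobi's identity for theta constants. -/
theorem th2_pow_four_add_th4_pow_four {t : ℝ} (ht : 0 < t) :
    th2 t 0 ^ 4 + th4 t 0 ^ 4 = th3 t 0 ^ 4 := by
  rw [show th2 t 0 ^ 4 = (th2 t 0 ^ 2) ^ 2 by ring, show th3 t 0 ^ 4 = (th3 t 0 ^ 2) ^ 2 by ring,
    show th4 t 0 ^ 4 = (th4 t 0 ^ 2) ^ 2 by ring, th3_sq ht, th4_sq ht, th2_sq ht, mul_zero]; ring

/-- Duplication formula: it carries zeros of θ₁ at parameter t to zeros at 2t, where the series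
converges faster. -/
theorem th1_mul_th2 {t : ℝ} (ht : 0 < t) (z : ℂ) :
    th1 t z * th2 t z = th4 (2 * t) 0 * th1 (2 * t) (2 * z) := by
  rw [th1, th2_mul_th2 ht, show z - 1 / 2 - z = -(1 / 2) by ring, th2_neg, th2_half, th3_neg, th4,
    th1, show z - 1 / 2 + z = 2 * z - 1 / 2 by ring, zero_add]
  ring

/-! ### The Wronskian of `θ₁` and `θ₄` -/

/-- An auxiliary quarter-period shift of `θ₃`, with doubled parameter. -/
def thAux (t : ℝ) (z : ℂ) : ℂ := cexp (-π * t / 8 + π * I * z / 2) * th3 (2 * t) (z + I * t / 2)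

lemma thAux_neg (t : ℝ) (z : ℂ) :
    thAux t (-z) = cexp (-π * t / 8 + π * I * z / 2) * th2 (2 * t) (z + I * t / 2) := by
  unfold thAux th2
  rw [← th3_neg, show -(-z + I * t / 2) = z - I * t / 2 by ring,
    show z + I * t / 2 + I * (2 * t : ℝ) / 2 = z - I * t / 2 + I * (2 * t : ℝ) by push_cast; ring,
    th3_add_period, ← mul_assoc, ← mul_assoc, ← Complex.exp_add, ← Complex.exp_add]
  congr 2
  push_cast
  linear_combination (-3 / 2 * π * t) * I_sq

lemma thAux_add_one (t : ℝ) (z : ℂ) : thAux t (z + 1) = I * thAux t z := by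
  unfold thAux
  rw [show z + 1 + I * t / 2 = z + I * t / 2 + 1 by ring, th3_add_one,
    show -π * t / 8 + π * I * (z + 1) / 2 = -π * t / 8 + π * I * z / 2 + π / 2 * I by ring,
    Complex.exp_add _ (π / 2 * I), Complex.exp_pi_div_two_mul_I]
  ring

lemma th2_mul_th3 {t : ℝ} (ht : 0 < t) (x y : ℂ) :
    th2 t x * th3 t y =
      thAux t (x + y) * thAux t (x - y) + thAux t (-(x + y)) * thAux t (-(x - y)) := by
  rw [thAux_neg, thAux_neg]
  unfold thAux
  have h := th3_mul_th3 ht (x + I * t / 2) y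
  rw [show x + I * t / 2 + y = x + y + I * t / 2 by ring,
    show x + I * t / 2 - y = x - y + I * t / 2 by ring] at h
  rw [th2, mul_assoc, h, show -π * t / 4 + π * I * x =
    (-π * t / 8 + π * I * (x + y) / 2) + (-π * t / 8 + π * I * (x - y) / 2) by ring,
    Complex.exp_add (-π * t / 8 + π * I * (x + y) / 2)]
  ring

/-- Moving both arguments of `th2_mul_th3` by half a unit fixes x + y and changes x - y by 1, where
`thAux` picks up a factor i. The sum of two products thus becomes a difference. -/
lemma th1_mul_th4 {t : ℝ} (ht : 0 < t) (x y : ℂ) :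
    th1 t x * th4 t y =
      -I * (thAux t (x + y) * thAux t (x - y) - thAux t (-(x + y)) * thAux t (-(x - y))) := by
  rw [th1, th4, th2_mul_th3 ht, show x - 1 / 2 + (y + 1 / 2) = x + y by ring,
    show -(x - 1 / 2 - (y + 1 / 2)) = -(x - y) + 1 by ring, thAux_add_one]
  have h := thAux_add_one t (x - 1 / 2 - (y + 1 / 2))
  rw [show x - 1 / 2 - (y + 1 / 2) + 1 = x - y by ring] at h
  rw [h]
  linear_combination (thAux t (x + y) * thAux t (x - 1 / 2 - (y + 1 / 2))) * I_sq

lemma differentiable_thAux {t : ℝ} (ht : 0 < t) : Differentiable ℂ (thAux t) := by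
  have := differentiable_th3 (t := 2 * t) (by positivity)
  unfold thAux
  fun_prop

/-- The Wronskian is the derivative at y = 0 of θ₁(z+y)θ₄(z-y). There the sum of arguments is
constantly 2z, so `th1_mul_th4` leaves only `thAux` at ±2y to differentiate. The resulting
dependence on z is that of θ₂θ₃ in `th2_mul_th3_self`. -/
lemma wronskian_thAux {t : ℝ} (ht : 0 < t) (z : ℂ) :
    deriv (th1 t) z * th4 t z - th1 t z * deriv (th4 t) z =
      -2 * I * deriv (thAux t) 0 * (thAux t (2 * z) + thAux t (-(2 * z))) := by
  have d1 : HasDerivAt (fun y => th1 t (z + y) * th4 t (z - y))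
      (deriv (th1 t) z * th4 t z - th1 t z * deriv (th4 t) z) 0 := by
    have a : HasDerivAt (fun y => th1 t (z + y)) (deriv (th1 t) z) 0 := by
      have := (differentiable_th1 ht (z + 0)).hasDerivAt.comp_const_add z 0
      simpa using this
    have b : HasDerivAt (fun y => th4 t (z - y)) (-deriv (th4 t) z) 0 := by
      have := (differentiable_th4 ht (z - 0)).hasDerivAt.comp_const_sub z 0
      simpa using this
    refine (a.mul b).congr_deriv ?_
    rw [add_zero, sub_zero]
    ring
  have d2 : HasDerivAt (fun y => th1 t (z + y) * th4 t (z - y))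
      (-2 * I * deriv (thAux t) 0 * (thAux t (2 * z) + thAux t (-(2 * z)))) 0 := by
    have e : (fun y => th1 t (z + y) * th4 t (z - y)) = fun y =>
        -I * (thAux t (2 * z) * thAux t (2 * y) - thAux t (-(2 * z)) * thAux t (-(2 * y))) := by
      funext y
      rw [th1_mul_th4 ht]
      ring_nf
    rw [e]
    have hA : HasDerivAt (thAux t) (deriv (thAux t) 0) (2 * 0) := by
      simpa using (differentiable_thAux ht 0).hasDerivAt
    have hB : HasDerivAt (thAux t) (deriv (thAux t) 0) (-(2 * 0)) := by
      simpa using (differentiable_thAux ht 0).hasDerivAt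
    have m : HasDerivAt (fun y : ℂ => 2 * y) 2 0 := by
      simpa using (hasDerivAt_id (0 : ℂ)).const_mul 2
    have a := hA.comp (0 : ℂ) m
    have b := hB.comp (0 : ℂ) m.neg
    refine (((a.const_mul (thAux t (2 * z))).sub
      (b.const_mul (thAux t (-(2 * z))))).const_mul (-I)).congr_deriv ?_
    ring
  exact d1.unique d2

lemma th2_mul_th3_self {t : ℝ} (ht : 0 < t) (z : ℂ) :
    th2 t z * th3 t z = thAux t 0 * (thAux t (2 * z) + thAux t (-(2 * z))) := by
  rw [th2_mul_th3 ht]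
  simp only [sub_self, neg_zero, two_mul]
  ring

/-- The Wronskian of `θ₁` and `θ₄` is proportional to `θ₂ θ₃`. -/
theorem wronskian_th1_th4 {t : ℝ} (ht : 0 < t) (z : ℂ) :
    (deriv (th1 t) z * th4 t z - th1 t z * deriv (th4 t) z) * (th2 t 0 * th3 t 0) =
      deriv (th1 t) 0 * th4 t 0 * (th2 t z * th3 t z) := by
  have h1 : th1 t 0 = 0 := by
    rw [th1, zero_sub, th2_neg, th2_half]
  have h := wronskian_thAux ht 0
  rw [h1, zero_mul, sub_zero, mul_zero, neg_zero] at h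
  rw [wronskian_thAux ht, h, th2_mul_th3_self ht, th2_mul_th3_self ht, mul_zero, neg_zero]
  ring

/-! ### Trigonometric series -/

lemma ofReal_exp_rpow (t x : ℝ) : ((rexp (-(π * t)) ^ x : ℝ) : ℂ) = cexp (-π * t * x) := by
  rw [← Real.exp_mul]
  push_cast
  ring_nf

lemma hasSum_th2 {t : ℝ} (ht : 0 < t) (z : ℂ) :
    HasSum (fun n : ℕ => 2 * (((rexp (-(π * t)) ^ (((n : ℝ) + 1 / 2) ^ 2) : ℝ) : ℂ) *
      Complex.cos ((2 * (n : ℂ) + 1) * (π * z)))) (th2 t z) := by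
  -- The terms n and -n-1 have the same Gaussian weight and combine into a cosine.
  have h := ((hasSum_jacobiTheta₂_term (z + I * t / 2) (im_I_mul_pos ht)).mul_left
    (cexp (-π * t / 4 + π * I * z))).nat_add_neg_add_one
  refine Eq.mpr (congrArg (fun f => HasSum f _) (funext fun n => ?_)) h
  rw [ofReal_exp_rpow, Complex.cos, jacobiTheta₂_term, jacobiTheta₂_term, ← Complex.exp_add,
    ← Complex.exp_add, mul_div_assoc', mul_div_assoc', mul_div_cancel_left₀ _ two_ne_zero, mul_add,
    ← Complex.exp_add, ← Complex.exp_add]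
  congr 2
  · push_cast
    linear_combination (-π * t * (n ^ 2 + n)) * I_sq
  · push_cast
    linear_combination (-π * t * (n ^ 2 + n)) * I_sq

lemma theta2_exp {t : ℝ} (ht : 0 < t) (z : ℂ) : theta2 (rexp (-(π * t))) (π * z) = th2 t z := by
  rw [← (hasSum_th2 ht z).tsum_eq, theta2, tsum_mul_left]

lemma cos_odd_mul_sub (n : ℕ) (u : ℂ) :
    Complex.cos ((2 * (n : ℂ) + 1) * (u - π / 2)) =
      (-1) ^ n * Complex.sin ((2 * (n : ℂ) + 1) * u) := by
  rw [show (2 * (n : ℂ) + 1) * (u - π / 2) = (2 * (n : ℂ) + 1) * u - π / 2 - n * π by ring,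
    Complex.cos_antiperiodic.sub_nat_mul_eq, Complex.cos_sub_pi_div_two]

lemma hasSum_th1 {t : ℝ} (ht : 0 < t) (z : ℂ) :
    HasSum (fun n : ℕ => 2 * ((-1 : ℂ) ^ n *
      ((rexp (-(π * t)) ^ (((n : ℝ) + 1 / 2) ^ 2) : ℝ) : ℂ) *
      Complex.sin ((2 * (n : ℂ) + 1) * (π * z)))) (th1 t z) := by
  have h := hasSum_th2 ht (z - 1 / 2)
  refine Eq.mpr (congrArg (fun f => HasSum f _) (funext fun n => ?_)) h
  rw [show (π : ℂ) * (z - 1 / 2) = π * z - π / 2 by ring, cos_odd_mul_sub]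
  ring

lemma theta1_exp {t : ℝ} (ht : 0 < t) (z : ℂ) : theta1 (rexp (-(π * t))) (π * z) = th1 t z := by
  rw [← (hasSum_th1 ht z).tsum_eq, theta1, tsum_mul_left]

lemma hasSum_th4 {t : ℝ} (ht : 0 < t) (z : ℂ) :
    HasSum (fun n : ℕ => 2 * ((-1 : ℂ) ^ (n + 1) * ((rexp (-(π * t)) ^ ((n + 1) ^ 2) : ℝ) : ℂ) *
      Complex.cos (2 * ((n : ℂ) + 1) * (π * z)))) (th4 t z - 1) := by
  have h := (hasSum_jacobiTheta₂_term (z + 1 / 2) (im_I_mul_pos ht)).nat_add_neg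
  rw [← hasSum_nat_add_iff' 1] at h
  have e0 : jacobiTheta₂_term 0 (z + 1 / 2) (I * t) = 1 := by simp [jacobiTheta₂_term]
  -- Pairing n with -n counts the index 0 twice; dropping that first pair leaves θ₄ - 1.
  have ev : jacobiTheta₂ (z + 1 / 2) (I * t) + jacobiTheta₂_term 0 (z + 1 / 2) (I * t) -
      ∑ i ∈ Finset.range 1, (jacobiTheta₂_term (i : ℕ) (z + 1 / 2) (I * t) +
        jacobiTheta₂_term (-(i : ℕ)) (z + 1 / 2) (I * t)) = th4 t z - 1 := by
    simp only [Finset.range_one, Finset.sum_singleton, Nat.cast_zero, neg_zero, e0, th4, th3]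
    ring
  rw [ev] at h
  refine Eq.mpr (congrArg (fun f => HasSum f _) (funext fun n => ?_)) h
  have e1 : (-1 : ℂ) ^ (n + 1) = cexp ((n + 1 : ℕ) * (π * I)) := by
    rw [Complex.exp_nat_mul, Complex.exp_pi_mul_I]
  have e2 : (-1 : ℂ) ^ (n + 1) = cexp (-((n + 1 : ℕ) * (π * I))) := by
    rw [Complex.exp_neg, ← e1, ← inv_pow]; norm_num
  have e3 : ((rexp (-(π * t)) ^ ((n + 1) ^ 2) : ℝ) : ℂ) = cexp (-π * t * (n + 1) ^ 2) := by
    rw [← Real.rpow_natCast, ofReal_exp_rpow]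
    push_cast
    rfl
  rw [Complex.cos, mul_div_assoc', mul_div_assoc', mul_div_cancel_left₀ _ two_ne_zero, mul_add]
  nth_rewrite 1 [e1]
  rw [e2, e3, jacobiTheta₂_term, jacobiTheta₂_term, ← Complex.exp_add,
    ← Complex.exp_add, ← Complex.exp_add, ← Complex.exp_add]
  congr 2
  · push_cast
    linear_combination (-π * t * (n + 1) ^ 2) * I_sq
  · push_cast
    linear_combination (-π * t * (n + 1) ^ 2) * I_sq

lemma theta4_exp {t : ℝ} (ht : 0 < t) (z : ℂ) : theta4 (rexp (-(π * t))) (π * z) = th4 t z := by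
  rw [theta4, ← tsum_mul_left, (hasSum_th4 ht z).tsum_eq]
  ring

/-! ### Jacobi's imaginary transformation -/

/-- The common factor in the imaginary transformation of the theta functions. -/
def modularFactor (t : ℝ) (u : ℂ) : ℂ := 1 / (t : ℂ) ^ (1 / 2 : ℂ) * cexp (π * t * u ^ 2)

lemma modularFactor_ne_zero {t : ℝ} (ht : 0 < t) (u : ℂ) : modularFactor t u ≠ 0 := by
  have : (t : ℂ) ≠ 0 := by exact_mod_cast ht.ne'
  unfold modularFactor
  refine mul_ne_zero (one_div_ne_zero ?_) (Complex.exp_ne_zero _)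
  rw [Ne, Complex.cpow_eq_zero_iff]
  tauto

lemma modularFactor_add (t : ℝ) (u v : ℂ) :
    modularFactor t (u + v) = modularFactor t u * cexp (π * t * (2 * u * v + v ^ 2)) := by
  unfold modularFactor
  rw [mul_assoc (1 / (t : ℂ) ^ (1 / 2 : ℂ)), ← Complex.exp_add]
  ring_nf

lemma th3_I_mul {t : ℝ} (ht : 0 < t) (u : ℂ) :
    th3 t (I * t * u) = modularFactor t u * th3 (1 / t) u := by
  have h0 : (t : ℂ) ≠ 0 := by exact_mod_cast ht.ne'
  have hI := I_ne_zero
  unfold th3 modularFactor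
  rw [jacobiTheta₂_functional_equation]
  have e1 : -I * (I * (t : ℂ)) = t := by linear_combination (-t : ℂ) * I_sq
  have e2 : -π * I * (I * t * u) ^ 2 / (I * t) = π * t * u ^ 2 := by
    rw [div_eq_iff (mul_ne_zero hI h0)]
    linear_combination (-π * I * t ^ 2 * u ^ 2) * I_sq
  have e3 : I * t * u / (I * t) = u := by
    rw [mul_div_cancel_left₀ _ (mul_ne_zero hI h0)]
  have e4 : -1 / (I * t) = I * (1 / t : ℝ) := by
    push_cast
    field_simp
    exact I_sq.symm
  rw [e1, e2, e3, e4]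

lemma th4_I_mul {t : ℝ} (ht : 0 < t) (u : ℂ) :
    th4 t (I * t * u) = modularFactor t u * th2 (1 / t) u := by
  have h0 : (t : ℂ) ≠ 0 := by exact_mod_cast ht.ne'
  rw [th4, ← th2_neg, th2, show I * t * u + 1 / 2 = I * t * (u + -I / (2 * t)) by
    field_simp; linear_combination I_sq, th3_I_mul ht, modularFactor_add, mul_assoc,
    ← th3_neg (1 / t)]
  congr 3
  · push_cast
    field_simp
    linear_combination 4 * I_sq
  · push_cast
    ring

lemma th2_I_mul {t : ℝ} (ht : 0 < t) (u : ℂ) :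
    th2 t (I * t * u) = modularFactor t u * th4 (1 / t) u := by
  rw [th4, th2, show I * t * u + I * t / 2 = I * t * (u + 1 / 2) by ring, th3_I_mul ht,
    modularFactor_add, ← mul_assoc, mul_comm (cexp _), mul_assoc (modularFactor t u),
    ← Complex.exp_add]
  have e : π * t * (2 * u * (1 / 2) + (1 / 2) ^ 2) + (-π * t / 4 + π * I * (I * t * u)) = 0 := by
    linear_combination (π * t * u) * I_sq
  rw [e, Complex.exp_zero, mul_one]

lemma th1_I_mul {t : ℝ} (ht : 0 < t) (u : ℂ) :
    th1 t (I * t * u) = I * modularFactor t u * th1 (1 / t) u := by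
  have h0 : (t : ℂ) ≠ 0 := by exact_mod_cast ht.ne'
  rw [th1, show I * t * u - 1 / 2 = I * t * (u + I / (2 * t)) by
    field_simp; linear_combination -I_sq, th2_I_mul ht, modularFactor_add, th1, th2, th4]
  have hp := th3_add_one (1 / t) (u - 1 / 2 + I * (1 / t : ℝ) / 2)
  rw [show u - 1 / 2 + I * (1 / t : ℝ) / 2 + 1 = u + I / (2 * t) + 1 / 2 by
    push_cast; field_simp; ring] at hp
  have he : cexp (π * t * (2 * u * (I / (2 * t)) + (I / (2 * t)) ^ 2)) =
      I * cexp (-π * (1 / t : ℝ) / 4 + π * I * (u - 1 / 2)) := by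
    rw [show I * cexp (-π * (1 / t : ℝ) / 4 + π * I * (u - 1 / 2)) =
      cexp (π / 2 * I) * cexp (-π * (1 / t : ℝ) / 4 + π * I * (u - 1 / 2)) by
        rw [Complex.exp_pi_div_two_mul_I], ← Complex.exp_add]
    congr 1
    push_cast
    field_simp
    linear_combination 4 * I_sq
  rw [hp, he]
  ring

/-! ### Real values and positivity -/

lemma th3_ofReal (t u : ℝ) : th3 t u = ((th3 t u).re : ℂ) := by
  rw [eq_comm, ← conj_eq_iff_re, th3_conj, conj_ofReal]

lemma th2_ofReal (t u : ℝ) : th2 t u = ((th2 t u).re : ℂ) := by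
  rw [eq_comm, ← conj_eq_iff_re, th2_conj, conj_ofReal]

lemma th1_ofReal (t u : ℝ) : th1 t u = ((th1 t u).re : ℂ) := by
  have := th2_ofReal t (u - 1 / 2)
  push_cast at this
  exact this

lemma th4_ofReal (t u : ℝ) : th4 t u = ((th4 t u).re : ℂ) := by
  have := th3_ofReal t (u + 1 / 2)
  push_cast at this
  exact this

lemma th3_I_mul_ofReal {t : ℝ} (ht : 0 < t) (v : ℝ) : ∃ r : ℝ, 0 < r ∧ th3 t (I * v) = r := by
  have h := hasSum_jacobiTheta₂_term (I * v) (im_I_mul_pos ht)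
  have e (n : ℤ) : jacobiTheta₂_term n (I * v) (I * t) =
      ((rexp (-2 * π * n * v - π * n ^ 2 * t) : ℝ) : ℂ) := by
    rw [jacobiTheta₂_term]
    push_cast
    congr 1
    linear_combination (2 * π * n * v + π * n ^ 2 * t) * I_sq
  simp only [e] at h
  have hs : Summable fun n : ℤ => rexp (-2 * π * n * v - π * n ^ 2 * t) :=
    Complex.summable_ofReal.mp h.summable
  refine ⟨∑' n : ℤ, rexp (-2 * π * n * v - π * n ^ 2 * t),
    hs.tsum_pos (fun n => (Real.exp_pos _).le) 0 (Real.exp_pos _), ?_⟩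
  rw [Complex.ofReal_tsum, h.tsum_eq, th3]

lemma modularFactor_ofReal {t : ℝ} (ht : 0 < t) (u : ℝ) :
    ∃ r : ℝ, 0 < r ∧ modularFactor t u = r := by
  refine ⟨1 / t ^ (1 / 2 : ℝ) * rexp (π * t * u ^ 2), by positivity, ?_⟩
  unfold modularFactor
  push_cast
  rw [Complex.ofReal_cpow ht.le]
  push_cast
  rfl

/-- On the real axis the series oscillates, but the imaginary transformation turns it into a series
of positive exponentials times a positive factor. -/
lemma th3_re_pos {t : ℝ} (ht : 0 < t) (u : ℝ) : 0 < (th3 t u).re := by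
  have ht' : 0 < 1 / t := by positivity
  have h := th3_I_mul ht' u
  obtain ⟨r, hr, er⟩ := modularFactor_ofReal ht' u
  obtain ⟨s, hs, es⟩ := th3_I_mul_ofReal ht' (1 / t * u)
  rw [er, one_div_one_div, show I * ((1 / t : ℝ) : ℂ) * u = I * ((1 / t * u : ℝ) : ℂ) by
    push_cast; ring, es, th3_ofReal] at h
  have h' : s = r * (th3 t u).re := by exact_mod_cast h
  exact (pos_iff_pos_of_mul_pos (h' ▸ hs)).mp hr

lemma th4_re_pos {t : ℝ} (ht : 0 < t) (u : ℝ) : 0 < (th4 t u).re := by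
  have := th3_re_pos ht (u + 1 / 2)
  push_cast at this
  exact this

lemma th2_zero_re_pos {t : ℝ} (ht : 0 < t) : 0 < (th2 t (0 : ℝ)).re := by
  obtain ⟨s, hs, es⟩ := th3_I_mul_ofReal ht (t / 2)
  have : th2 t (0 : ℝ) = ((rexp (-π * t / 4) * s : ℝ) : ℂ) := by
    rw [th2]
    push_cast
    rw [← es]
    push_cast
    ring_nf
  rw [this, ofReal_re]
  positivity

lemma th3_ne_zero {t : ℝ} (ht : 0 < t) (u : ℝ) : th3 t u ≠ 0 := fun h =>
  (th3_re_pos ht u).ne' (by rw [h, zero_re])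

lemma th4_ne_zero {t : ℝ} (ht : 0 < t) (u : ℝ) : th4 t u ≠ 0 := fun h =>
  (th4_re_pos ht u).ne' (by rw [h, zero_re])

lemma th2_zero_ne_zero {t : ℝ} (ht : 0 < t) : th2 t 0 ≠ 0 := fun h =>
  (th2_zero_re_pos ht).ne' (by rw [ofReal_zero, h, zero_re])

lemma th3_zero_ne_zero {t : ℝ} (ht : 0 < t) : th3 t 0 ≠ 0 := by
  simpa using th3_ne_zero ht 0

lemma th4_zero_ne_zero {t : ℝ} (ht : 0 < t) : th4 t 0 ≠ 0 := by
  simpa using th4_ne_zero ht 0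

/-! ### Zeros of θ₁ and θ₂ on the real axis -/

lemma abs_sin_nat_mul_le (n : ℕ) (x : ℝ) : |Real.sin (n * x)| ≤ n * |Real.sin x| := by
  induction n with
  | zero => simp
  | succ n ih =>
    push_cast
    rw [add_mul, one_mul, Real.sin_add, add_mul, one_mul]
    refine (abs_add_le _ _).trans (add_le_add ?_ ?_)
    · rw [abs_mul]
      exact (mul_le_of_le_one_right (abs_nonneg _) (Real.abs_cos_le_one _)).trans ih
    · rw [abs_mul]
      exact mul_le_of_le_one_left (abs_nonneg _) (Real.abs_cos_le_one _)

lemma two_mul_add_one_le_three_pow (n : ℕ) : 2 * n + 1 ≤ 3 ^ n := by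
  induction n with
  | zero => simp
  | succ n ih => rw [pow_succ]; omega

/-- For small q the first term of the sine series dominates the tail. Bounding every sine by a
multiple of sin(πu) keeps this uniform as u tends to 0. -/
lemma th1_ne_zero_of_one_le {t : ℝ} (ht : 1 ≤ t) {u : ℝ} (hu : u ∈ Ioc (0 : ℝ) (1 / 2)) :
    th1 t u ≠ 0 := by
  have ht0 : 0 < t := by linarith
  have hsin : 0 < Real.sin (π * u) :=
    Real.sin_pos_of_pos_of_lt_pi (mul_pos pi_pos hu.1) (by nlinarith [pi_pos, hu.2])
  set q := rexp (-(π * t)) with hq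
  have hq0 : 0 < q := Real.exp_pos _
  -- Ratio of the majorant: q² comes from (n+1/2)² ≥ 1/4 + 2n, and 3 from |sin((2n+1)x)| ≤ 3ⁿ|sin
  -- x|. A ratio below 1/2 makes the tail smaller than the first term.
  set r := 3 * q ^ 2 with hr
  have hr0 : 0 < r := by positivity
  have hr1 : r < 1 / 2 := by
    have h1 : q ≤ rexp (-π) := Real.exp_le_exp.mpr (by nlinarith [pi_pos])
    have h2 : rexp π ≥ 1 + π := by linarith [Real.add_one_le_exp π]
    have h3 : rexp (-π) * rexp π = 1 := by rw [← Real.exp_add]; simp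
    have h4 : q * 4 < 1 := by nlinarith [pi_gt_three, Real.exp_pos (-π)]
    nlinarith
  have hq4 : 0 < q ^ (1 / 4 : ℝ) := Real.rpow_pos_of_pos hq0 _
  set A := 2 * q ^ (1 / 4 : ℝ) * Real.sin (π * u) with hA
  have hA0 : 0 < A := by positivity
  have h := hasSum_th1 ht0 (u : ℂ)
  set f : ℕ → ℂ := fun n => 2 * ((-1 : ℂ) ^ n *
      ((q ^ (((n : ℝ) + 1 / 2) ^ 2) : ℝ) : ℂ) *
      Complex.sin ((2 * (n : ℂ) + 1) * (π * (u : ℂ)))) with hf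
  have hb (n : ℕ) : ‖f n‖ ≤ A * r ^ n := by
    have e1 : Complex.sin ((2 * (n : ℂ) + 1) * (π * (u : ℂ))) =
        ((Real.sin ((2 * n + 1 : ℕ) * (π * u)) : ℝ) : ℂ) := by push_cast; rfl
    have e2 : q ^ (((n : ℝ) + 1 / 2) ^ 2) ≤ q ^ (1 / 4 : ℝ) * (q ^ 2) ^ n := by
      rw [← pow_mul, ← Real.rpow_natCast q, ← Real.rpow_add hq0]
      refine Real.rpow_le_rpow_of_exponent_ge hq0 (Real.exp_le_one_iff.mpr (by nlinarith [pi_pos])) ?_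
      push_cast
      rcases Nat.eq_zero_or_pos n with h | h
      · subst h; norm_num
      · have : (1 : ℝ) ≤ n := by exact_mod_cast h
        nlinarith
    have e3 : |Real.sin ((2 * n + 1 : ℕ) * (π * u))| ≤ 3 ^ n * Real.sin (π * u) := by
      refine (abs_sin_nat_mul_le _ _).trans ?_
      rw [abs_of_pos hsin]
      refine mul_le_mul_of_nonneg_right ?_ hsin.le
      exact_mod_cast two_mul_add_one_le_three_pow n
    rw [hf]
    simp only [norm_mul, norm_pow, norm_neg, norm_one, one_pow, one_mul, e1, Complex.norm_real,
      Complex.norm_two, Real.norm_eq_abs, abs_of_pos (Real.rpow_pos_of_pos hq0 _)]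
    calc 2 * (q ^ (((n : ℝ) + 1 / 2) ^ 2) * |Real.sin ((2 * n + 1 : ℕ) * (π * u))|)
        ≤ 2 * ((q ^ (1 / 4 : ℝ) * (q ^ 2) ^ n) * (3 ^ n * Real.sin (π * u))) := by gcongr
      _ = A * r ^ n := by rw [hA, hr, mul_pow]; ring
  have hg : HasSum (fun n : ℕ => A * r ^ (n + 1)) (A * (r * (1 - r)⁻¹)) := by
    have := ((hasSum_geometric_of_lt_one hr0.le (by linarith)).mul_left r).mul_left A
    simpa [pow_succ'] using this
  have hle := tsum_of_norm_bounded hg fun n => hb (n + 1)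
  have hsplit := h.summable.sum_add_tsum_nat_add 1
  rw [h.tsum_eq, Finset.sum_range_one] at hsplit
  intro h0
  have hf0 : f 0 = (A : ℂ) := by
    rw [hf, hA]
    push_cast
    norm_num
    ring
  rw [h0, hf0] at hsplit
  rw [show ∑' i, f (i + 1) = -(A : ℂ) by linear_combination hsplit, norm_neg, Complex.norm_real,
    Real.norm_of_nonneg hA0.le] at hle
  have h1 : r * (1 - r)⁻¹ < 1 := by
    rw [← div_eq_mul_inv, div_lt_one (by linarith)]
    linarith
  nlinarith

lemma th1_half (t : ℝ) : th1 t (1 / 2) = th2 t 0 := by rw [th1, sub_self]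

lemma th1_one_sub (t : ℝ) (z : ℂ) : th1 t (1 - z) = th1 t z := by
  rw [th1, th1, ← th2_neg]
  ring_nf

/-- A zero at (t, u) propagates by duplication to (2t, 2u), reflected into the interval if needed;
after finitely many doublings the parameter is at least 1. -/
theorem th1_ne_zero {t : ℝ} (ht : 0 < t) {u : ℝ} (hu : u ∈ Ioc (0 : ℝ) (1 / 2)) :
    th1 t u ≠ 0 := by
  obtain ⟨n, hn⟩ : ∃ n : ℕ, 1 ≤ 2 ^ n * t := by
    obtain ⟨n, hn⟩ := pow_unbounded_of_one_lt (1 / t) (one_lt_two : (1 : ℝ) < 2)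
    exact ⟨n, by rw [div_lt_iff₀ ht] at hn; exact hn.le⟩
  induction n generalizing t u with
  | zero => exact th1_ne_zero_of_one_le (by simpa using hn) hu
  | succ n ih =>
    intro h
    have h2t : 0 < 2 * t := by positivity
    have hn' : 1 ≤ 2 ^ n * (2 * t) := by rw [pow_succ] at hn; linarith
    -- The endpoint is separate: doubling 1/2 gives 1, a genuine zero of θ₁.
    rcases hu.2.eq_or_lt with e | hlt
    · rw [e] at h
      push_cast at h
      rw [th1_half] at h
      exact th2_zero_ne_zero ht h
    · have h0 := th1_mul_th2 ht u
      rw [h, zero_mul, eq_comm, mul_eq_zero, or_iff_right (th4_zero_ne_zero h2t)] at h0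
      rcases le_total (2 * u) (1 / 2) with hle | hle
      · refine ih (u := 2 * u) h2t ⟨by linarith [hu.1], hle⟩ hn' ?_
        push_cast
        exact h0
      · refine ih (u := 1 - 2 * u) h2t ⟨by linarith, by linarith⟩ hn' ?_
        push_cast
        rw [th1_one_sub]
        exact h0

lemma th2_ne_zero {t : ℝ} (ht : 0 < t) {u : ℝ} (hu : u ∈ Ico (0 : ℝ) (1 / 2)) :
    th2 t u ≠ 0 := by
  have h := th1_ne_zero ht (u := 1 / 2 - u) ⟨by linarith [hu.2], by linarith [hu.1]⟩
  push_cast at h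
  rwa [th1, show 1 / 2 - (u : ℂ) - 1 / 2 = -u by ring, th2_neg] at h

lemma th2_re_pos {t : ℝ} (ht : 0 < t) {u : ℝ} (hu : u ∈ Ico (0 : ℝ) (1 / 2)) :
    0 < (th2 t u).re := by
  by_contra! hneg
  have hc : Continuous fun x : ℝ => (th2 t x).re :=
    continuous_re.comp ((differentiable_th2 ht).continuous.comp continuous_ofReal)
  obtain ⟨x, hx, hx0⟩ := intermediate_value_Icc' hu.1 hc.continuousOn
    ⟨hneg, (th2_zero_re_pos ht).le⟩
  refine th2_ne_zero ht (u := x) ⟨hx.1, hx.2.trans_lt hu.2⟩ ?_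
  rw [th2_ofReal]
  simp only at hx0
  rw [hx0, ofReal_zero]

/-! ### The modulus as a function of `t` -/

/-- The modulus `θ₂(0)² / θ₃(0)²`. -/
def modulus (t : ℝ) : ℝ := ((th2 t 0).re / (th3 t 0).re) ^ 2

lemma th3_zero_re_pos {t : ℝ} (ht : 0 < t) : 0 < (th3 t 0).re := by
  simpa using th3_re_pos ht 0

lemma th4_zero_re_pos {t : ℝ} (ht : 0 < t) : 0 < (th4 t 0).re := by
  simpa using th4_re_pos ht 0

lemma th2_zero_ofReal (t : ℝ) : th2 t 0 = ((th2 t 0).re : ℂ) := by simpa using th2_ofReal t 0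

lemma th3_zero_ofReal (t : ℝ) : th3 t 0 = ((th3 t 0).re : ℂ) := by simpa using th3_ofReal t 0

lemma th4_zero_ofReal (t : ℝ) : th4 t 0 = ((th4 t 0).re : ℂ) := by simpa using th4_ofReal t 0

lemma th2_zero_re_pos' {t : ℝ} (ht : 0 < t) : 0 < (th2 t 0).re := by
  simpa using th2_zero_re_pos ht

lemma ofReal_modulus (t : ℝ) : (modulus t : ℂ) = (th2 t 0 / th3 t 0) ^ 2 := by
  rw [modulus]
  push_cast
  rw [← th2_zero_ofReal, ← th3_zero_ofReal]

lemma modulus_pos {t : ℝ} (ht : 0 < t) : 0 < modulus t :=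
  pow_pos (div_pos (th2_zero_re_pos' ht) (th3_zero_re_pos ht)) 2

lemma modulus_sq_add {t : ℝ} (ht : 0 < t) :
    modulus t ^ 2 + ((th4 t 0).re / (th3 t 0).re) ^ 4 = 1 := by
  have h := th2_pow_four_add_th4_pow_four ht
  rw [th2_zero_ofReal, th3_zero_ofReal, th4_zero_ofReal] at h
  have h' : (th2 t 0).re ^ 4 + (th4 t 0).re ^ 4 = (th3 t 0).re ^ 4 := by exact_mod_cast h
  have h3 := (th3_zero_re_pos ht).ne'
  rw [modulus, div_pow, div_pow, ← pow_mul]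
  norm_num
  field_simp
  linarith

lemma modulus_lt_one {t : ℝ} (ht : 0 < t) : modulus t < 1 := by
  have h := modulus_sq_add ht
  have h4 : 0 < ((th4 t 0).re / (th3 t 0).re) ^ 4 :=
    pow_pos (div_pos (th4_zero_re_pos ht) (th3_zero_re_pos ht)) 4
  nlinarith [modulus_pos ht]

lemma th2_zero_eq {t : ℝ} (ht : 0 < t) : th2 t 0 = modularFactor t 0 * th4 (1 / t) 0 := by
  simpa using th2_I_mul ht 0

lemma th3_zero_eq {t : ℝ} (ht : 0 < t) : th3 t 0 = modularFactor t 0 * th3 (1 / t) 0 := by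
  simpa using th3_I_mul ht 0

lemma th4_zero_eq {t : ℝ} (ht : 0 < t) : th4 t 0 = modularFactor t 0 * th2 (1 / t) 0 := by
  simpa using th4_I_mul ht 0

lemma modulus_one_div {t : ℝ} (ht : 0 < t) :
    modulus (1 / t) = ((th4 t 0).re / (th3 t 0).re) ^ 2 := by
  have h : ((modulus (1 / t) : ℝ) : ℂ) = (((th4 t 0).re / (th3 t 0).re) ^ 2 : ℝ) := by
    rw [ofReal_modulus]
    push_cast
    rw [← th4_zero_ofReal, ← th3_zero_ofReal, th4_zero_eq ht, th3_zero_eq ht,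
      mul_div_mul_left _ _ (modularFactor_ne_zero ht 0)]
  exact_mod_cast h

lemma modulus_sq_add_modulus_one_div_sq {t : ℝ} (ht : 0 < t) :
    modulus t ^ 2 + modulus (1 / t) ^ 2 = 1 := by
  rw [modulus_one_div ht, ← pow_mul]
  exact modulus_sq_add ht

lemma compl_modulus {t : ℝ} (ht : 0 < t) : compl (modulus t) = modulus (1 / t) := by
  rw [compl, show 1 - modulus t ^ 2 = modulus (1 / t) ^ 2 by
    linarith [modulus_sq_add_modulus_one_div_sq ht],
    Real.sqrt_sq (modulus_pos (one_div_pos.mpr ht)).le]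

/-- Landen's transformation: with A = θ₃(0) and B = θ₂(0) at 2t, the two moduli are (B/A)² and
2AB/(A²+B²), and B < A. Iterating drives the modulus to 0. -/
lemma modulus_two_mul_le {t : ℝ} (ht : 0 < t) : modulus (2 * t) ≤ modulus t ^ 2 := by
  have h2t : 0 < 2 * t := by positivity
  have e3 := th3_sq ht 0
  have e2 := th2_sq ht 0
  rw [mul_zero, th2_zero_ofReal (2 * t), th3_zero_ofReal (2 * t)] at e2 e3
  rw [th3_zero_ofReal] at e3
  rw [th2_zero_ofReal] at e2
  have a := th3_zero_re_pos h2t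
  have b := th2_zero_re_pos' h2t
  have hlt := modulus_lt_one h2t
  unfold modulus at hlt ⊢
  set A := (th3 (2 * t) 0).re
  set B := (th2 (2 * t) 0).re
  have e3' : (th3 t 0).re ^ 2 = A * A + B * B := by exact_mod_cast e3
  have e2' : (th2 t 0).re ^ 2 = B * A + A * B := by exact_mod_cast e2
  have hBA : B < A := by
    rw [div_pow, div_lt_one (by positivity)] at hlt
    exact lt_of_pow_lt_pow_left₀ 2 a.le hlt
  rw [div_pow (th2 t 0).re, e2', e3']
  refine pow_le_pow_left₀ (by positivity) ?_ 2
  rw [div_le_div_iff₀ a (by positivity)]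
  nlinarith [mul_pos a b]

lemma modulus_two_pow_le (n : ℕ) : modulus (2 ^ n) ≤ modulus 1 ^ 2 ^ n := by
  induction n with
  | zero => simp
  | succ n ih =>
    rw [pow_succ', pow_succ, pow_mul]
    exact (modulus_two_mul_le (by positivity)).trans
      (pow_le_pow_left₀ (modulus_pos (by positivity)).le ih 2)

lemma exists_modulus_lt {k : ℝ} (hk : 0 < k) : ∃ t : ℝ, 0 < t ∧ modulus t < k := by
  obtain ⟨n, hn⟩ := exists_pow_lt_of_lt_one hk (modulus_lt_one one_pos)
  refine ⟨2 ^ n, by positivity, (modulus_two_pow_le n).trans_lt (lt_of_le_of_lt ?_ hn)⟩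
  exact pow_le_pow_of_le_one (modulus_pos one_pos).le (modulus_lt_one one_pos).le
    Nat.lt_two_pow_self.le

lemma continuousOn_modulus : ContinuousOn modulus (Ioi 0) := by
  intro t ht
  have ht' : 0 < t := ht
  refine ContinuousAt.continuousWithinAt ?_
  have h3 (f : ℝ → ℂ) (hf : Continuous f) : ContinuousAt (fun s : ℝ => th3 s (f s)) t :=
    (continuousAt_jacobiTheta₂ (f t) (im_I_mul_pos ht')).comp
      (f := fun s : ℝ => (f s, I * (s : ℂ))) (by fun_prop)
  have c3 := h3 (fun _ => 0) continuous_const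
  have c2 : ContinuousAt (fun s : ℝ => th2 s 0) t := by
    unfold th2
    exact ContinuousAt.mul (by fun_prop) (h3 (fun s => 0 + I * s / 2) (by fun_prop))
  unfold modulus
  exact ((continuous_re.continuousAt.comp c2).div (continuous_re.continuousAt.comp c3)
    (th3_zero_re_pos ht').ne').pow 2

/-- Intermediate values: the modulus gets below k, and it gets above k because t ↦ 1/t exchanges it
with the complementary modulus, which can be made smaller than √(1-k²). -/
theorem exists_modulus_eq {k : ℝ} (hk : k ∈ Ioo (0 : ℝ) 1) : ∃ t : ℝ, 0 < t ∧ modulus t = k := by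
  obtain ⟨a, ha, hak⟩ := exists_modulus_lt hk.1
  have h1 : 0 < 1 - k ^ 2 := by nlinarith [hk.1, hk.2]
  obtain ⟨b, hb, hbk⟩ := exists_modulus_lt (Real.sqrt_pos.mpr h1)
  have hb' : k ≤ modulus (1 / b) := by
    have h := modulus_sq_add_modulus_one_div_sq hb
    have h2 : modulus b ^ 2 < 1 - k ^ 2 := by
      rw [← Real.sq_sqrt h1.le]
      exact pow_lt_pow_left₀ hbk (modulus_pos hb).le two_ne_zero
    have h3 := modulus_pos (one_div_pos.mpr hb)
    nlinarith [hk.1]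
  obtain ⟨t, ht, e⟩ := isPreconnected_Ioi.intermediate_value (mem_Ioi.mpr ha)
    (mem_Ioi.mpr (one_div_pos.mpr hb)) continuousOn_modulus ⟨hak.le, hb'⟩
  exact ⟨t, ht, e⟩

/-! ### Jacobi elliptic functions as theta quotients -/

/-- `sn`, with periods normalised so that `K = 1/2`. -/
def thSn (t : ℝ) (z : ℂ) : ℂ := th3 t 0 / th2 t 0 * (th1 t z / th4 t z)

/-- `cn`, with periods normalised so that `K = 1/2`. -/
def thCn (t : ℝ) (z : ℂ) : ℂ := th4 t 0 / th2 t 0 * (th2 t z / th4 t z)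

/-- `dn`, with periods normalised so that `K = 1/2`. -/
def thDn (t : ℝ) (z : ℂ) : ℂ := th4 t 0 / th3 t 0 * (th3 t z / th4 t z)

/-- The derivative of `thSn` at the origin, equal to `2K`. -/
def thScale (t : ℝ) : ℂ := deriv (th1 t) 0 * th3 t 0 / (th2 t 0 * th4 t 0)

lemma thSn_sq_add_thCn_sq {t : ℝ} (ht : 0 < t) {z : ℂ} (hz : th4 t z ≠ 0) :
    thSn t z ^ 2 + thCn t z ^ 2 = 1 := by
  have h := th1_sq_add_th2_sq ht z
  have h2 := th2_zero_ne_zero ht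
  unfold thSn thCn
  field_simp
  linear_combination h

lemma thDn_sq {t : ℝ} (ht : 0 < t) {z : ℂ} (hz : th4 t z ≠ 0) :
    thDn t z ^ 2 = 1 - (modulus t : ℂ) ^ 2 * thSn t z ^ 2 := by
  have h := th1_sq_add_th3_sq ht z
  have h2 := th2_zero_ne_zero ht
  have h3 := th3_zero_ne_zero ht
  rw [ofReal_modulus]
  unfold thSn thDn
  field_simp
  linear_combination h

lemma hasDerivAt_thSn {t : ℝ} (ht : 0 < t) {z : ℂ} (hz : th4 t z ≠ 0) :
    HasDerivAt (thSn t) (thScale t * thCn t z * thDn t z) z := by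
  have h1 := (differentiable_th1 ht z).hasDerivAt
  have h4 := (differentiable_th4 ht z).hasDerivAt
  refine ((h1.div h4 hz).const_mul (th3 t 0 / th2 t 0)).congr_deriv ?_
  have hW := wronskian_th1_th4 ht z
  have n2 := th2_zero_ne_zero ht
  have n3 := th3_zero_ne_zero ht
  have n4 := th4_zero_ne_zero ht
  unfold thCn thDn thScale
  field_simp
  linear_combination hW

lemma th1_zero (t : ℝ) : th1 t 0 = 0 := by rw [th1, zero_sub, th2_neg, th2_half]

lemma thSn_zero (t : ℝ) : thSn t 0 = 0 := by rw [thSn, th1_zero]; simp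

lemma thSn_half {t : ℝ} (ht : 0 < t) : thSn t (1 / 2) = 1 := by
  have n2 := th2_zero_ne_zero ht
  have n3 := th3_zero_ne_zero ht
  have e : th4 t (1 / 2) = th3 t 0 := by
    rw [th4, show (1 / 2 + 1 / 2 : ℂ) = 0 + 1 by norm_num, th3_add_one]
  rw [thSn, th1_half, e]
  field_simp

lemma thSn_ofReal (t u : ℝ) : thSn t u = ((thSn t u).re : ℂ) := by
  have : thSn t u =
      (((th3 t 0).re / (th2 t 0).re * ((th1 t u).re / (th4 t u).re) : ℝ) : ℂ) := by
    push_cast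
    rw [← th3_zero_ofReal, ← th2_zero_ofReal, ← th1_ofReal, ← th4_ofReal, thSn]
  rw [this, ofReal_re]

lemma thCn_ofReal (t u : ℝ) : thCn t u =
    (((th4 t 0).re / (th2 t 0).re * ((th2 t u).re / (th4 t u).re) : ℝ) : ℂ) := by
  push_cast
  rw [← th4_zero_ofReal, ← th2_zero_ofReal, ← th2_ofReal, ← th4_ofReal, thCn]

lemma thDn_ofReal (t u : ℝ) : thDn t u =
    (((th4 t 0).re / (th3 t 0).re * ((th3 t u).re / (th4 t u).re) : ℝ) : ℂ) := by
  push_cast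
  rw [← th4_zero_ofReal, ← th3_zero_ofReal, ← th3_ofReal, ← th4_ofReal, thDn]

lemma thCn_zero {t : ℝ} (ht : 0 < t) : thCn t 0 = 1 := by
  have n2 := th2_zero_ne_zero ht
  have n4 := th4_zero_ne_zero ht
  unfold thCn
  field_simp

lemma thDn_zero {t : ℝ} (ht : 0 < t) : thDn t 0 = 1 := by
  have n3 := th3_zero_ne_zero ht
  have n4 := th4_zero_ne_zero ht
  unfold thDn
  field_simp

lemma thScale_ofReal {t : ℝ} (ht : 0 < t) : thScale t = ((thScale t).re : ℂ) := by
  have h := hasDerivAt_thSn ht (th4_zero_ne_zero ht)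
  rw [thCn_zero ht, thDn_zero ht, mul_one, mul_one, ← ofReal_zero] at h
  have h' := Complex.imCLM.hasFDerivAt.comp_hasDerivAt (0 : ℝ) h.comp_ofReal
  have e : (⇑Complex.imCLM ∘ fun x : ℝ => thSn t x) = fun _ => 0 := by
    funext x
    rw [Function.comp_apply, thSn_ofReal]
    simp
  rw [e] at h'
  have him : (thScale t).im = 0 := by simpa using h'.unique (hasDerivAt_const (0 : ℝ) (0 : ℝ))
  exact Complex.ext (by simp) (by simp [him])

/-- Differentiating the imaginary transformation of θ₁ at its zero 0, where the derivative of the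
modular factor drops out. This is what becomes K' = tK. -/
lemma thScale_one_div {t : ℝ} (ht : 0 < t) : thScale (1 / t) = t * thScale t := by
  have ht' : 0 < 1 / t := by positivity
  have hG : DifferentiableAt ℂ (modularFactor t) 0 := by
    unfold modularFactor
    fun_prop
  have hl : HasDerivAt (fun u : ℂ => th1 t (I * t * u)) (I * t * deriv (th1 t) 0) 0 := by
    have h1 : HasDerivAt (th1 t) (deriv (th1 t) 0) (I * t * 0) := by
      rw [mul_zero]
      exact (differentiable_th1 ht 0).hasDerivAt
    have m : HasDerivAt (fun u : ℂ => I * t * u) (I * t) 0 := by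
      simpa using (hasDerivAt_id (0 : ℂ)).const_mul (I * (t : ℂ))
    exact (h1.comp (0 : ℂ) m).congr_deriv (by ring)
  have hr : HasDerivAt (fun u : ℂ => th1 t (I * t * u))
      (I * modularFactor t 0 * deriv (th1 (1 / t)) 0) 0 := by
    rw [show (fun u : ℂ => th1 t (I * t * u)) =
      fun u => I * modularFactor t u * th1 (1 / t) u from funext (th1_I_mul ht)]
    refine ((hG.hasDerivAt.const_mul I).mul
      (differentiable_th1 ht' 0).hasDerivAt).congr_deriv ?_
    rw [th1_zero]
    ring
  have h := hl.unique hr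
  have h' : (t : ℂ) * deriv (th1 t) 0 = modularFactor t 0 * deriv (th1 (1 / t)) 0 :=
    mul_left_cancel₀ I_ne_zero (by linear_combination h)
  have hg := modularFactor_ne_zero ht 0
  have n2 := th2_zero_ne_zero ht'
  have n4 := th4_zero_ne_zero ht'
  unfold thScale
  rw [th2_zero_eq ht, th3_zero_eq ht, th4_zero_eq ht, ← mul_div_assoc, ← mul_assoc, h']
  field_simp

/-! ### Inversion of the elliptic integral -/

lemma one_sub_mul_sin_sq_pos {k : ℝ} (hk : k ∈ Ioo (0 : ℝ) 1) (x : ℝ) :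
    0 < 1 - k ^ 2 * Real.sin x ^ 2 := by
  have h1 : k ^ 2 < 1 := by nlinarith [hk.1, hk.2]
  nlinarith [Real.sin_sq_le_one x, sq_nonneg (Real.sin x), sq_nonneg k]

lemma continuous_ellipticF_integrand {k : ℝ} (hk : k ∈ Ioo (0 : ℝ) 1) :
    Continuous fun t : ℝ => 1 / Real.sqrt (1 - k ^ 2 * Real.sin t ^ 2) :=
  continuous_const.div (by fun_prop) fun x => (Real.sqrt_pos.mpr (one_sub_mul_sin_sq_pos hk x)).ne'

lemma hasDerivAt_ellipticF {k : ℝ} (hk : k ∈ Ioo (0 : ℝ) 1) (φ : ℝ) :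
    HasDerivAt (fun φ => ellipticF φ k) (1 / Real.sqrt (1 - k ^ 2 * Real.sin φ ^ 2)) φ :=
  ((continuous_ellipticF_integrand hk).integral_hasStrictDerivAt 0 φ).hasDerivAt

lemma ellipticK_pos {k : ℝ} (hk : k ∈ Ioo (0 : ℝ) 1) : 0 < ellipticK k :=
  intervalIntegral.intervalIntegral_pos_of_pos
    ((continuous_ellipticF_integrand hk).intervalIntegrable _ _)
    (fun x => one_div_pos.mpr (Real.sqrt_pos.mpr (one_sub_mul_sin_sq_pos hk x))) (by positivity)

lemma modulus_mem {t : ℝ} (ht : 0 < t) : modulus t ∈ Ioo (0 : ℝ) 1 :=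
  ⟨modulus_pos ht, modulus_lt_one ht⟩

lemma hasDerivAt_thSn_re {t : ℝ} (ht : 0 < t) (u : ℝ) :
    HasDerivAt (fun x : ℝ => (thSn t x).re) ((thScale t * thCn t u * thDn t u).re) u :=
  (hasDerivAt_thSn ht (th4_ne_zero ht u)).real_of_complex

/-- By sn' = c cn dn the chain rule gives derivative c: arcsin contributes 1/cn and the integrand
1/dn. Positivity of cn and dn fixes the signs of the square roots. -/
theorem ellipticF_arcsin_thSn {t : ℝ} (ht : 0 < t) {u : ℝ} (hu : u ∈ Icc (0 : ℝ) (1 / 2)) :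
    ellipticF (Real.arcsin (thSn t u).re) (modulus t) = (thScale t).re * u := by
  have hk := modulus_mem ht
  set c := (thScale t).re with hc
  have hcont : Continuous fun x : ℝ => (thSn t x).re :=
    continuous_iff_continuousAt.mpr fun x => (hasDerivAt_thSn_re ht x).continuousAt
  have hF : Continuous fun φ => ellipticF φ (modulus t) :=
    continuous_iff_continuousAt.mpr fun x => (hasDerivAt_ellipticF hk x).continuousAt
  -- Only the half-open interval needs a derivative; at 1/2, where cn = 0, arcsin is not
  -- differentiable at sn = 1.
  have key := constant_of_has_deriv_right_zero (a := 0) (b := 1 / 2)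
    (f := fun x : ℝ => ellipticF (Real.arcsin (thSn t x).re) (modulus t) - c * x)
    ((hF.comp (Real.continuous_arcsin.comp hcont)).sub (by fun_prop)).continuousOn ?_ u hu
  · simp only [ofReal_zero, thSn_zero, zero_re, Real.arcsin_zero, mul_zero, sub_zero] at key
    have h0 : ellipticF 0 (modulus t) = 0 := by simp [ellipticF]
    linarith
  · intro x hx
    refine HasDerivAt.hasDerivWithinAt ?_
    have n4 := th4_ne_zero ht x
    have hs := thSn_sq_add_thCn_sq ht n4
    have hd := thDn_sq ht n4
    have hcn := thCn_ofReal t x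
    have hdn := thDn_ofReal t x
    have hD := hasDerivAt_thSn_re ht x
    have p2 := th2_re_pos ht hx
    have p3 := th3_re_pos ht x
    have p4 := th4_re_pos ht x
    have q2 := th2_zero_re_pos' ht
    have q3 := th3_zero_re_pos ht
    have q4 := th4_zero_re_pos ht
    set S := (thSn t x).re with hS
    set C := (th4 t 0).re / (th2 t 0).re * ((th2 t x).re / (th4 t x).re) with hC
    set D := (th4 t 0).re / (th3 t 0).re * ((th3 t x).re / (th4 t x).re) with hDd
    have C0 : 0 < C := by positivity
    have D0 : 0 < D := by positivity
    rw [thSn_ofReal, ← hS, hcn] at hs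
    rw [thSn_ofReal, ← hS, hdn] at hd
    have hs' : S ^ 2 + C ^ 2 = 1 := by exact_mod_cast hs
    have hd' : D ^ 2 = 1 - modulus t ^ 2 * S ^ 2 := by exact_mod_cast hd
    rw [hcn, hdn, thScale_ofReal ht, ← hc] at hD
    have hD' : HasDerivAt (fun x : ℝ => (thSn t x).re) (c * C * D) x :=
      hD.congr_deriv (by rw [← ofReal_mul, ← ofReal_mul, ofReal_re])
    have hS1 : S ^ 2 < 1 := by nlinarith
    have hSlt : S < 1 := by nlinarith
    have hSgt : -1 < S := by nlinarith
    have hA : HasDerivAt (fun x : ℝ => Real.arcsin (thSn t x).re)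
        (1 / Real.sqrt (1 - S ^ 2) * (c * C * D)) x :=
      HasDerivAt.comp (h₂ := Real.arcsin) x (Real.hasDerivAt_arcsin hSgt.ne' hSlt.ne) hD'
    have hE := (hasDerivAt_ellipticF hk (Real.arcsin S)).comp x hA
    rw [Real.sin_arcsin hSgt.le hSlt.le, ← hd', Real.sqrt_sq D0.le,
      show 1 - S ^ 2 = C ^ 2 by linarith, Real.sqrt_sq C0.le] at hE
    refine (hE.sub ((hasDerivAt_id x).const_mul c)).congr_deriv ?_
    field_simp
    ring

lemma ellipticK_modulus {t : ℝ} (ht : 0 < t) : ellipticK (modulus t) = (thScale t).re / 2 := by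
  have h := ellipticF_arcsin_thSn ht (u := 1 / 2) ⟨by norm_num, le_rfl⟩
  push_cast at h
  rw [thSn_half ht, one_re, Real.arcsin_one] at h
  rw [ellipticK, h]
  ring

lemma thScale_re_pos {t : ℝ} (ht : 0 < t) : 0 < (thScale t).re := by
  have := ellipticK_pos (modulus_mem ht)
  rw [ellipticK_modulus ht] at this
  linarith

lemma ellipticK'_modulus {t : ℝ} (ht : 0 < t) :
    ellipticK' (modulus t) = t * (thScale t).re / 2 := by
  rw [ellipticK', compl_modulus ht, ellipticK_modulus (one_div_pos.mpr ht), thScale_one_div ht,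
    re_ofReal_mul]

lemma nome_modulus {t : ℝ} (ht : 0 < t) : nome (modulus t) = rexp (-(π * t)) := by
  have h := (thScale_re_pos ht).ne'
  rw [nome, ellipticK_modulus ht, ellipticK'_modulus ht]
  congr 2
  field_simp

/-- The elliptic integral inverts `sn`. -/
theorem exists_thSn_eq {t : ℝ} (ht : 0 < t) {s : ℝ} (hs : s ∈ Icc (0 : ℝ) 1) :
    ∃ u ∈ Icc (0 : ℝ) (1 / 2), thSn t u = s ∧
      ellipticF (Real.arcsin s) (modulus t) = (thScale t).re * u := by
  have hcont : Continuous fun x : ℝ => (thSn t x).re :=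
    continuous_iff_continuousAt.mpr fun x => (hasDerivAt_thSn_re ht x).continuousAt
  have h0 : (thSn t (0 : ℝ)).re = 0 := by rw [ofReal_zero, thSn_zero, zero_re]
  have h1 : (thSn t (1 / 2 : ℝ)).re = 1 := by push_cast; rw [thSn_half ht, one_re]
  obtain ⟨u, hu, e⟩ := intermediate_value_Icc (by norm_num : (0 : ℝ) ≤ 1 / 2) hcont.continuousOn
    (show s ∈ Icc (thSn t (0 : ℝ)).re (thSn t (1 / 2 : ℝ)).re by rwa [h0, h1])
  simp only at e
  exact ⟨u, hu, by rw [thSn_ofReal, e], by rw [← e, ellipticF_arcsin_thSn ht hu]⟩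

/-! ### Theta quotients at shifted arguments -/

lemma th2_add_half (t : ℝ) (z : ℂ) : th2 t (z + 1 / 2) = -th1 t z := by
  rw [th1, ← th2_add_one]
  ring_nf

lemma th4_add_half (t : ℝ) (z : ℂ) : th4 t (z + 1 / 2) = th3 t z := by
  rw [th4, add_assoc, add_halves, th3_add_one]

lemma ofReal_modulus_one_div_sq {t : ℝ} (ht : 0 < t) :
    (modulus (1 / t) : ℂ) ^ 2 = 1 - (modulus t : ℂ) ^ 2 := by
  have h := modulus_sq_add_modulus_one_div_sq ht
  have h' : modulus (1 / t) ^ 2 = 1 - modulus t ^ 2 := by linarith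
  exact_mod_cast h'

/-- Classically cn²(K+iv, k) = -k'² sn²(v, k')/dn²(v, k'); it serves the vertical segment of the
path. -/
lemma thCn_imaginary_sq {t : ℝ} (ht : 0 < t) {u : ℂ} (h3 : th3 (1 / t) u ≠ 0)
    (h4 : th4 (1 / t) u ≠ 0) :
    thCn t (I * t * u + 1 / 2) ^ 2 * thDn (1 / t) u ^ 2 =
      -((modulus (1 / t) : ℂ) ^ 2 * thSn (1 / t) u ^ 2) := by
  have ht' : 0 < 1 / t := by positivity
  have hG := modularFactor_ne_zero ht
  have n2 := th2_zero_ne_zero ht'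
  have n3 := th3_zero_ne_zero ht'
  have n4 := th4_zero_ne_zero ht'
  rw [ofReal_modulus, thCn, th4_add_half, th2_add_half, th4_zero_eq ht, th2_zero_eq ht,
    th3_I_mul ht, th1_I_mul ht, thDn, thSn, mul_div_mul_left _ _ (hG 0),
    show -(I * modularFactor t u * th1 (1 / t) u) / (modularFactor t u * th3 (1 / t) u) =
      -I * (th1 (1 / t) u / th3 (1 / t) u) by have := hG u; field_simp]
  field_simp
  linear_combination (th1 (1 / t) u ^ 2) * I_sq

lemma th4_add_quarter (t : ℝ) (z : ℂ) :
    th4 t (z + 1 / 2 + I * t / 2) = cexp (π * t / 4 - π * I * z) * th2 t z := by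
  rw [show z + 1 / 2 + I * t / 2 = z + I * t / 2 + 1 / 2 by ring, th4_add_half,
    th3_add_half_period]

/-- Classically cn(u+K+iK') = -ik'/(k cn u); a zero of θ₂ at z would be a pole of the shifted
function. -/
lemma thCn_add_quarter_sq {t : ℝ} (ht : 0 < t) {z : ℂ} (h2 : th2 t z ≠ 0) (h4 : th4 t z ≠ 0) :
    (modulus t : ℂ) ^ 2 * (thCn t (z + 1 / 2 + I * t / 2) ^ 2 * thCn t z ^ 2) =
      (modulus t : ℂ) ^ 2 - 1 := by
  have n2 := th2_zero_ne_zero ht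
  have n3 := th3_zero_ne_zero ht
  have he := Complex.exp_ne_zero (π * t / 4 - π * I * z)
  have e : th2 t (z + 1 / 2 + I * t / 2) = -I * cexp (π * t / 4 - π * I * z) * th4 t z := by
    rw [th2_add_half_period, ← th4,
      show π * t / 4 - π * I * (z + 1 / 2) = -(π / 2 * I) + (π * t / 4 - π * I * z) by ring,
      Complex.exp_add, Complex.exp_neg, Complex.exp_pi_div_two_mul_I, inv_I]
  rw [thCn, e, th4_add_quarter, thCn, ofReal_modulus]
  field_simp
  linear_combination (th4 t 0 ^ 4) * I_sq - th2_pow_four_add_th4_pow_four ht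

/-! ### The functions of the statement in terms of `t` -/

lemma scaledArg_modulus {t : ℝ} (ht : 0 < t) (x : ℂ) :
    scaledArg (modulus t) x = π * (x / (thScale t).re) := by
  have : ((thScale t).re : ℂ) ≠ 0 := by exact_mod_cast (thScale_re_pos ht).ne'
  rw [scaledArg, ellipticK_modulus ht]
  push_cast
  field_simp

lemma jacobiH_modulus {t : ℝ} (ht : 0 < t) :
    jacobiH (modulus t) = fun x => th1 t (x / (thScale t).re) := by
  funext x
  rw [jacobiH, nome_modulus ht, scaledArg_modulus ht, theta1_exp ht]

lemma jacobiTheta_modulus {t : ℝ} (ht : 0 < t) :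
    jacobiTheta (modulus t) = fun x => th4 t (x / (thScale t).re) := by
  funext x
  rw [jacobiTheta, nome_modulus ht, scaledArg_modulus ht, theta4_exp ht]

lemma jacobiCn_modulus {t : ℝ} (ht : 0 < t) (x : ℂ) :
    jacobiCn (modulus t) x = thCn t (x / (thScale t).re) := by
  rw [jacobiCn, nome_modulus ht, scaledArg_modulus ht, theta4_exp ht, theta2_exp ht,
    ← mul_zero (π : ℂ), theta4_exp ht, theta2_exp ht, thCn]

lemma characteristicEq_modulus {t : ℝ} (ht : 0 < t) (lam : ℝ) (α : ℂ) :
    CharacteristicEq (modulus t) lam α ↔ th4 t (α / (thScale t).re) ≠ 0 ∧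
      (lam : ℂ) = 1 - 2 * (modulus t : ℂ) ^ 2 +
        (modulus t : ℂ) ^ 2 * thCn t (α / (thScale t).re) ^ 2 := by
  rw [CharacteristicEq, jacobiTheta_modulus ht, jacobiCn_modulus ht]

/-! ### The explicit parameter solves the characteristic equation -/

lemma characteristicEq_real {t : ℝ} (ht : 0 < t) {lam : ℝ} (h1 : 1 - 2 * modulus t ^ 2 ≤ lam)
    (h2 : lam ≤ 1 - modulus t ^ 2) :
    CharacteristicEq (modulus t) lam
      (ellipticF (Real.arcsin (Real.sqrt (1 - modulus t ^ 2 - lam) / modulus t)) (modulus t)) := by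
  have hc : ((thScale t).re : ℂ) ≠ 0 := by exact_mod_cast (thScale_re_pos ht).ne'
  have hk := modulus_pos ht
  have hs : Real.sqrt (1 - modulus t ^ 2 - lam) / modulus t ∈ Icc (0 : ℝ) 1 := by
    refine ⟨by positivity, (div_le_one hk).mpr (Real.sqrt_le_iff.mpr ⟨hk.le, by linarith⟩)⟩
  have hs2 : modulus t ^ 2 * (Real.sqrt (1 - modulus t ^ 2 - lam) / modulus t) ^ 2 =
      1 - modulus t ^ 2 - lam := by
    rw [div_pow, Real.sq_sqrt (by linarith)]
    field_simp
  generalize Real.sqrt (1 - modulus t ^ 2 - lam) / modulus t = s at hs hs2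
  obtain ⟨u, -, hu, e⟩ := exists_thSn_eq ht hs
  have n4 := th4_ne_zero ht u
  rw [characteristicEq_modulus ht, e, ofReal_mul, mul_div_cancel_left₀ _ hc]
  refine ⟨n4, ?_⟩
  have h := thSn_sq_add_thCn_sq ht n4
  rw [hu] at h
  have hs2' : (modulus t : ℂ) ^ 2 * (s : ℂ) ^ 2 = 1 - (modulus t : ℂ) ^ 2 - lam := by
    exact_mod_cast hs2
  linear_combination hs2' - (modulus t : ℂ) ^ 2 * h

lemma characteristicEq_vertical {t : ℝ} (ht : 0 < t) {lam : ℝ} (h1 : -modulus t ^ 2 ≤ lam)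
    (h2 : lam ≤ 1 - 2 * modulus t ^ 2) :
    CharacteristicEq (modulus t) lam ((ellipticK (modulus t) : ℂ) + I *
      (ellipticF (Real.arcsin (Real.sqrt (1 - 2 * modulus t ^ 2 - lam) /
        Real.sqrt ((1 - modulus t ^ 2) * (1 - modulus t ^ 2 - lam)))) (compl (modulus t)) : ℂ)) := by
  have ht' : 0 < 1 / t := by positivity
  have hc : ((thScale t).re : ℂ) ≠ 0 := by exact_mod_cast (thScale_re_pos ht).ne'
  have hk := modulus_pos ht
  have hk1 : 0 < 1 - modulus t ^ 2 := by nlinarith [modulus_lt_one ht]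
  have hl : 0 < 1 - modulus t ^ 2 - lam := by nlinarith
  have hs : Real.sqrt (1 - 2 * modulus t ^ 2 - lam) /
        Real.sqrt ((1 - modulus t ^ 2) * (1 - modulus t ^ 2 - lam)) ∈ Icc (0 : ℝ) 1 := by
    refine ⟨by positivity, div_le_one_of_le₀ (Real.sqrt_le_sqrt ?_) (Real.sqrt_nonneg _)⟩
    -- The two sides differ by k²(k² + λ).
    nlinarith [mul_nonneg (sq_nonneg (modulus t)) (by linarith : 0 ≤ modulus t ^ 2 + lam)]
  have hs2 : (1 - modulus t ^ 2) * (Real.sqrt (1 - 2 * modulus t ^ 2 - lam) /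
        Real.sqrt ((1 - modulus t ^ 2) * (1 - modulus t ^ 2 - lam))) ^ 2 *
        (1 - modulus t ^ 2 - lam) = 1 - 2 * modulus t ^ 2 - lam := by
    rw [div_pow, Real.sq_sqrt (by linarith), Real.sq_sqrt (by positivity)]
    field_simp
  generalize Real.sqrt (1 - 2 * modulus t ^ 2 - lam) /
    Real.sqrt ((1 - modulus t ^ 2) * (1 - modulus t ^ 2 - lam)) = s at hs hs2
  obtain ⟨u, -, hu, e⟩ := exists_thSn_eq ht' hs
  have n4 := th4_ne_zero ht' u
  have n3 := th3_ne_zero ht' u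
  have ez : ((ellipticK (modulus t) : ℂ) + I * (ellipticF (Real.arcsin s) (compl (modulus t)) : ℂ)) /
      (thScale t).re = I * t * u + 1 / 2 := by
    rw [compl_modulus ht, e, ellipticK_modulus ht, thScale_one_div ht, re_ofReal_mul]
    push_cast
    field_simp
    ring
  rw [characteristicEq_modulus ht, ez]
  constructor
  · rw [th4_add_half, th3_I_mul ht]
    exact mul_ne_zero (modularFactor_ne_zero ht _) n3
  · have h := thCn_imaginary_sq ht n3 n4
    rw [thDn_sq ht' n4, hu, ofReal_modulus_one_div_sq ht] at h
    have hs2' : (1 - (modulus t : ℂ) ^ 2) * (s : ℂ) ^ 2 * (1 - (modulus t : ℂ) ^ 2 - lam) =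
        1 - 2 * (modulus t : ℂ) ^ 2 - lam := by exact_mod_cast hs2
    set X := thCn t (I * t * u + 1 / 2) ^ 2
    have hX : (modulus t : ℂ) ^ 2 * X = -(1 - 2 * (modulus t : ℂ) ^ 2 - lam) := by
      linear_combination (1 - (modulus t : ℂ) ^ 2 - lam) * h + (X - 1) * hs2'
    linear_combination -hX

lemma characteristicEq_shifted {t : ℝ} (ht : 0 < t) {lam : ℝ} (h1 : lam < -modulus t ^ 2) :
    CharacteristicEq (modulus t) lam
      ((ellipticK (modulus t) : ℂ) + I * (ellipticK' (modulus t) : ℂ) +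
        (ellipticF (Real.arcsin (Real.sqrt (-modulus t ^ 2 - lam) /
          Real.sqrt (1 - 2 * modulus t ^ 2 - lam))) (modulus t) : ℂ)) := by
  have hc : ((thScale t).re : ℂ) ≠ 0 := by exact_mod_cast (thScale_re_pos ht).ne'
  have hk1 : 0 < 1 - modulus t ^ 2 := by nlinarith [modulus_lt_one ht, modulus_pos ht]
  have hl : 0 < 1 - 2 * modulus t ^ 2 - lam := by linarith
  have hs0 : 0 ≤ Real.sqrt (-modulus t ^ 2 - lam) / Real.sqrt (1 - 2 * modulus t ^ 2 - lam) := by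
    positivity
  have hs1 : Real.sqrt (-modulus t ^ 2 - lam) / Real.sqrt (1 - 2 * modulus t ^ 2 - lam) < 1 :=
    (div_lt_one (Real.sqrt_pos.mpr hl)).mpr (Real.sqrt_lt_sqrt (by linarith) (by linarith))
  have hs2 : (Real.sqrt (-modulus t ^ 2 - lam) / Real.sqrt (1 - 2 * modulus t ^ 2 - lam)) ^ 2 *
      (1 - 2 * modulus t ^ 2 - lam) = -modulus t ^ 2 - lam := by
    rw [div_pow, Real.sq_sqrt (by linarith), Real.sq_sqrt hl.le, div_mul_cancel₀ _ hl.ne']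
  generalize Real.sqrt (-modulus t ^ 2 - lam) / Real.sqrt (1 - 2 * modulus t ^ 2 - lam) = s
    at hs0 hs1 hs2
  obtain ⟨u, hu0, hu, e⟩ := exists_thSn_eq ht ⟨hs0, hs1.le⟩
  -- Strictness keeps γ away from K, where α would be a pole of cn.
  have hult : u < 1 / 2 := by
    refine lt_of_le_of_ne hu0.2 fun h => hs1.ne ?_
    rw [h] at hu
    push_cast at hu
    rw [thSn_half ht] at hu
    exact_mod_cast hu.symm
  have n2 := th2_ne_zero ht ⟨hu0.1, hult⟩
  have n4 := th4_ne_zero ht u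
  have ez : ((ellipticK (modulus t) : ℂ) + I * (ellipticK' (modulus t) : ℂ) +
      (ellipticF (Real.arcsin s) (modulus t) : ℂ)) / (thScale t).re = u + 1 / 2 + I * t / 2 := by
    rw [e, ellipticK_modulus ht, ellipticK'_modulus ht]
    push_cast
    field_simp
    ring
  rw [characteristicEq_modulus ht, ez]
  constructor
  · rw [th4_add_quarter]
    exact mul_ne_zero (Complex.exp_ne_zero _) n2
  · have h := thCn_add_quarter_sq ht n2 n4
    have h' := thSn_sq_add_thCn_sq ht n4
    rw [hu] at h'
    have hs2' : (s : ℂ) ^ 2 * (1 - 2 * (modulus t : ℂ) ^ 2 - lam) = -(modulus t : ℂ) ^ 2 - lam := by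
      exact_mod_cast hs2
    have hk1' : 1 - (modulus t : ℂ) ^ 2 ≠ 0 := by exact_mod_cast hk1.ne'
    set X := thCn t (u + 1 / 2 + I * t / 2) ^ 2
    have hX : (modulus t : ℂ) ^ 2 * X = -(1 - 2 * (modulus t : ℂ) ^ 2 - lam) := by
      refine mul_left_cancel₀ hk1' ?_
      linear_combination (1 - 2 * (modulus t : ℂ) ^ 2 - lam) * h + (modulus t : ℂ) ^ 2 * X * hs2' -
        (modulus t : ℂ) ^ 2 * X * (1 - 2 * (modulus t : ℂ) ^ 2 - lam) * h'
    linear_combination -hX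

theorem characteristicEq_pathAlpha {t : ℝ} (ht : 0 < t) {lam : ℝ}
    (h : lam ≤ 1 - modulus t ^ 2) :
    CharacteristicEq (modulus t) lam (pathAlpha (modulus t) lam) := by
  unfold pathAlpha
  split_ifs with h1 h2
  · exact characteristicEq_real ht h1 h
  · exact characteristicEq_vertical ht h2 (not_le.mp h1).le
  · exact characteristicEq_shifted ht (not_le.mp h2)

/-! ### The frequency -/

lemma deriv_comp_div (f : ℂ → ℂ) (hf : Differentiable ℂ f) (c x : ℂ) :
    deriv (fun x => f (x / c)) x = deriv f (x / c) / c := by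
  have h := (hf (x / c)).hasDerivAt.comp x ((hasDerivAt_id x).div_const c)
  rw [show (fun x => f (x / c)) = f ∘ fun x => id x / c from rfl, h.deriv]
  ring

/-- The square of the frequency is a cubic polynomial in `λ`. -/
theorem omega_sq {t : ℝ} (ht : 0 < t) {lam : ℝ} {α : ℂ} (h : CharacteristicEq (modulus t) lam α)
    (hlam : lam ≠ 1 - modulus t ^ 2) :
    jacobiH (modulus t) α ≠ 0 ∧ omega (modulus t) lam α ^ 2 =
      ((16 * (1 - modulus t ^ 2 - lam) * (lam - 1 + 2 * modulus t ^ 2) * (lam + modulus t ^ 2) : ℝ)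
        : ℂ) := by
  rw [characteristicEq_modulus ht] at h
  obtain ⟨n4, hl⟩ := h
  have hc : ((thScale t).re : ℂ) ≠ 0 := by exact_mod_cast (thScale_re_pos ht).ne'
  have hcs := thScale_ofReal ht
  rw [omega, jacobiH_modulus ht, jacobiTheta_modulus ht, deriv_comp_div _ (differentiable_th1 ht),
    deriv_comp_div _ (differentiable_th4 ht)]
  beta_reduce
  generalize hcc : ((thScale t).re : ℂ) = c at *
  generalize α / c = z at *
  have hsc := thSn_sq_add_thCn_sq ht n4
  have hd := thDn_sq ht n4
  have hsn : (modulus t : ℂ) ^ 2 * thSn t z ^ 2 = 1 - (modulus t : ℂ) ^ 2 - lam := by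
    linear_combination (modulus t : ℂ) ^ 2 * hsc + hl
  have hl' : 1 - (modulus t : ℂ) ^ 2 - lam ≠ 0 := by
    have : 1 - modulus t ^ 2 - lam ≠ 0 := fun h => hlam (by linarith)
    exact_mod_cast this
  have hsn0 : thSn t z ≠ 0 := fun h0 => hl' (by rw [← hsn, h0]; ring)
  have n1 : th1 t z ≠ 0 := fun h0 => hsn0 (by rw [thSn, h0]; ring)
  refine ⟨n1, ?_⟩
  -- The logarithmic derivative of sn, read off from the Wronskian; the rescaling by c = 2K cancels
  -- the constant in sn' = c cn dn.
  have hS : deriv (th1 t) z / c / th1 t z - deriv (th4 t) z / c / th4 t z =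
      thCn t z * thDn t z / thSn t z := by
    have hW := wronskian_th1_th4 ht z
    have n2 := th2_zero_ne_zero ht
    have n3 := th3_zero_ne_zero ht
    have n40 := th4_zero_ne_zero ht
    have hcd : c * (th2 t 0 * th4 t 0) = deriv (th1 t) 0 * th3 t 0 := by
      rw [← hcs, thScale, div_mul_cancel₀ _ (mul_ne_zero n2 n40)]
    have e : thCn t z * thDn t z / thSn t z =
        th4 t 0 ^ 2 * (th2 t z * th3 t z) / (th3 t 0 ^ 2 * (th1 t z * th4 t z)) := by
      unfold thCn thDn thSn
      field_simp
    rw [e, eq_div_iff (by positivity)]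
    field_simp
    refine mul_left_cancel₀ n2 ?_
    linear_combination th3 t 0 * hW - th4 t 0 * (th2 t z * th3 t z) * hcd
  -- The prefactor -4k² sn² absorbs the denominator sn.
  have hom : 4 * ((lam : ℂ) + (modulus t : ℂ) ^ 2 - 1) *
      (deriv (th4 t) z / c / th4 t z - deriv (th1 t) z / c / th1 t z) =
      4 * (modulus t : ℂ) ^ 2 * thSn t z * thCn t z * thDn t z := by
    rw [show deriv (th4 t) z / c / th4 t z - deriv (th1 t) z / c / th1 t z =
      -(thCn t z * thDn t z / thSn t z) by rw [← hS]; ring,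
      show (lam : ℂ) + (modulus t : ℂ) ^ 2 - 1 = -((modulus t : ℂ) ^ 2 * thSn t z ^ 2) by
        rw [hsn]; ring]
    field_simp
  rw [hom]
  have hcn : (modulus t : ℂ) ^ 2 * thCn t z ^ 2 = lam - 1 + 2 * (modulus t : ℂ) ^ 2 := by
    linear_combination -hl
  have hdn : thDn t z ^ 2 = lam + (modulus t : ℂ) ^ 2 := by linear_combination hd - hsn
  push_cast
  rw [← hsn, ← hcn, ← hdn]
  ring

lemma exists_ofReal_of_sq_nonneg {w : ℂ} {r : ℝ} (hr : 0 ≤ r) (h : w ^ 2 = (r : ℂ)) :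
    ∃ x : ℝ, w = (x : ℂ) := by
  have hs : w ^ 2 = ((Real.sqrt r : ℝ) : ℂ) ^ 2 := by
    rw [h, ← ofReal_pow, Real.sq_sqrt hr]
  rcases sq_eq_sq_iff_eq_or_eq_neg.mp hs with e | e
  · exact ⟨_, e⟩
  · exact ⟨-Real.sqrt r, by rw [e, ofReal_neg]⟩

lemma exists_I_mul_ofReal_of_sq_nonpos {w : ℂ} {r : ℝ} (hr : r ≤ 0) (h : w ^ 2 = (r : ℂ)) :
    ∃ x : ℝ, w = I * (x : ℂ) := by
  have h' : (-I * w) ^ 2 = ((-r : ℝ) : ℂ) := by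
    push_cast
    rw [← h]
    linear_combination w ^ 2 * I_sq
  obtain ⟨x, hx⟩ := exists_ofReal_of_sq_nonneg (neg_nonneg.mpr hr) h'
  exact ⟨x, by rw [← hx]; linear_combination w * I_sq⟩

end LameKdV

end

theorem proposition4p1 (k : ℝ) (hk : k ∈ Set.Ioo (0 : ℝ) 1) (lam : ℝ) (α : ℂ)
    (hα : LameKdV.CharacteristicEq k lam α ∨ α = LameKdV.pathAlpha k lam) :
    (lam ∈ Set.Iio (-k ^ 2) ∪ Set.Ioo (1 - 2 * k ^ 2) (1 - k ^ 2) →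
      LameKdV.jacobiTheta k α ≠ 0 ∧ LameKdV.jacobiH k α ≠ 0 ∧
        ∃ w : ℝ, LameKdV.omega k lam α = (w : ℂ)) ∧
    (lam ∈ Set.Icc (-k ^ 2) (1 - 2 * k ^ 2) →
      LameKdV.jacobiTheta k α ≠ 0 ∧ LameKdV.jacobiH k α ≠ 0 ∧
        ∃ w : ℝ, LameKdV.omega k lam α = Complex.I * (w : ℂ)) := by
  obtain ⟨t, ht, rfl⟩ := LameKdV.exists_modulus_eq hk
  have hk0 : 0 < LameKdV.modulus t ^ 2 := pow_pos hk.1 2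
  -- Every λ in the statement lies strictly below 1-k², so both descriptions of α reduce to the
  -- characteristic equation.
  have key (hlam : lam < 1 - LameKdV.modulus t ^ 2) : LameKdV.CharacteristicEq (LameKdV.modulus t) lam α := by
    rcases hα with h | rfl
    · exact h
    · exact LameKdV.characteristicEq_pathAlpha ht hlam.le
  have hk1 : LameKdV.modulus t ^ 2 < 1 := by nlinarith [hk.1, hk.2]
  constructor
  · rintro (h | h)
    · have h' : lam < -LameKdV.modulus t ^ 2 := h
      have hc := key (by linarith)
      obtain ⟨hH, hw⟩ := LameKdV.omega_sq ht hc (by linarith)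
      refine ⟨hc.1, hH, LameKdV.exists_ofReal_of_sq_nonneg ?_ hw⟩
      refine mul_nonneg_of_nonpos_of_nonpos (mul_nonpos_of_nonneg_of_nonpos ?_ ?_) ?_ <;> linarith
    · have hc := key h.2
      obtain ⟨hH, hw⟩ := LameKdV.omega_sq ht hc h.2.ne
      refine ⟨hc.1, hH, LameKdV.exists_ofReal_of_sq_nonneg ?_ hw⟩
      refine mul_nonneg (mul_nonneg ?_ ?_) ?_ <;> linarith [h.1, h.2]
  · intro h
    have hlt : lam < 1 - LameKdV.modulus t ^ 2 := by linarith [h.2]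
    have hc := key hlt
    obtain ⟨hH, hw⟩ := LameKdV.omega_sq ht hc hlt.ne
    refine ⟨hc.1, hH, LameKdV.exists_I_mul_ofReal_of_sq_nonpos ?_ hw⟩
    refine mul_nonpos_of_nonpos_of_nonneg (mul_nonpos_of_nonneg_of_nonpos ?_ ?_) ?_ <;>
      linarith [h.1, h.2]
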